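/- Write $\widehat f(\xi)=\int_{\mathbb R^2}e^{-2\pi i x\cdot\xi}f(x)\,dx$, so that $|\nabla|$ is the Fourier multiplier with symbol $2\pi|\xi|$. Let $\psi\in C_c^\infty(\mathbb R^2)$ be non-negative, supported in the unit ball, with $\sum_{k\in\mathbb Z^2}\psi(\xi-k)=1$ for all $\xi\in\mathbb R^2$, and let $P_kf=\mathcal F^{-1}\big(\psi(\cdot-k)\widehat f\,\big)$ for $k\in\mathbb Z^2$. Let $(\varepsilon_k)_{k\in\mathbb Z^2}$ and $(\nu_k)_{k\in\mathbb Z^2}$ be two families of independent Rademacher random variables (values $\pm1$ with probability $\tfrac12$ each) on a probability space $(\Omega,\mathcal A,\mathbb P)$; nothing is assumed on the joint law of the two families. Let $\phi_0\in H^1(\mathbb R^2)$ and $\phi_1\in L^2(\mathbb R^2)$ be complex-valued (in particular, they may be real-valued). Then the randomized data $$\phi^\omega=(\phi_0^\omega,\phi_1^\omega)=\Big(\sum_{k\in\mathbb Z^2}\varepsilon_k(\omega)P_k\phi_0,\ \sum_{k\in\mathbb Z^2}\nu_k(\omega)P_k\phi_1\Big)$$ exist as a limit in $L^2(\Omega;H^1(\mathbb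 R^2)\times L^2(\mathbb R^2))$ of the finite partial sums. Let $$u^{(0)}(t)=\cos(t|\nabla|)\phi_0^\omega+\frac{\sin(t|\nabla|)}{|\nabla|}\phi_1^\omega$$ be the free wave evolution of any version of $\phi^\omega$, let $2\le q,r<\infty$, and let $I\subset\mathbb R$ be a bounded interval. Then, almost surely, $u^{(0)}$ has a time derivative $\partial_tu^{(0)}(t)\in L^2(\mathbb R^2)$ (as a curve in $L^2(\mathbb R^2)$) and weak spatial derivatives $\partial_{x_1}u^{(0)}(t),\partial_{x_2}u^{(0)}(t)\in L^2(\mathbb R^2)$ for every $t\in\mathbb R$, and $$\|\partial u^{(0)}\|_{L^q_tL^r_x(I\times\mathbb R^2)}<\infty\qquad\text{for each }\partial\in\{\partial_t,\partial_{x_1},\partial_{x_2}\},$$ where $\|v\|_{L^q_tL^r_x(I\times\mathbb R^2)}$ is the $L^q(I)$ norm of the measurable function $t\mapsto\|v(t)\|_{L^r(\mathbb R^2)}$. -/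

import Mathlib

open MeasureTheory ProbabilityTheory Filter Topology FourierTransform TemperedDistribution
open scoped ENNReal NNReal SchwartzMap LineDeriv

noncomputable section

namespace RandomWave

/-- The plane `ℝ²` with its Euclidean norm. -/
abbrev Plane := EuclideanSpace ℝ (Fin 2)

/-- The complex Hilbert space `L²(ℝ²)`. -/
abbrev L2 := Lp (α := Plane) ℂ 2 (volume : Measure Plane)

/-- The point of `ℝ²` with integer coordinates `k`. -/
def latticePoint (k : Fin 2 → ℤ) : Plane := WithLp.toLp 2 fun i => (k i : ℝ)

/-- The symbol `2π|ξ|` of `|∇|`, for the Fourier transform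
`𝓕 f ξ = ∫ exp (-2πi x·ξ) f x dx`. -/
def absNabla (ξ : Plane) : ℝ := 2 * Real.pi * ‖ξ‖

open Classical in
/-- The Fourier multiplier `𝓕⁻¹ (m · 𝓕 f)` on its natural domain in `L²`, i.e. for those `f ∈ L²`
with `m · 𝓕 f ∈ L²` (for a bounded measurable symbol `m`, all of `L²`); set to `0` elsewhere. -/
def fourierMul (m : Plane → ℂ) (f : L2) : L2 :=
  if h : MemLp (fun ξ => m ξ * (𝓕 f : L2) ξ) 2 (volume : Measure Plane) then
    𝓕⁻ (h.toLp _ : L2)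
  else 0

/-- The norm of `H¹(ℝ²)`, `‖(1 + |∇|²)^{1/2} f‖_{L²}`, with value `∞` for `f ∉ H¹`. -/
def h1ENorm (f : L2) : ℝ≥0∞ :=
  eLpNorm (fun ξ => ((Real.sqrt (1 + absNabla ξ ^ 2) : ℝ) : ℂ) * (𝓕 f : L2) ξ) 2
    (volume : Measure Plane)

/-- The unit-scale frequency projection `P_k f = 𝓕⁻¹ (ψ(ξ - k) 𝓕 f(ξ))`. -/
def unitProj (ψ : Plane → ℝ) (k : Fin 2 → ℤ) (f : L2) : L2 :=
  fourierMul (fun ξ => (ψ (ξ - latticePoint k) : ℂ)) f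

/-- The cut-off functions: smooth, nonnegative, supported in the unit ball, and
with `∑_{k ∈ ℤ²} ψ(ξ - k) = 1` for every `ξ`. -/
structure IsUnitCutoff (ψ : Plane → ℝ) : Prop where
  contDiff : ContDiff ℝ (⊤ : ℕ∞) ψ
  nonneg : ∀ ξ, 0 ≤ ψ ξ
  support : tsupport ψ ⊆ Metric.closedBall 0 1
  hasSum_one : ∀ ξ, HasSum (fun k : Fin 2 → ℤ => ψ (ξ - latticePoint k)) 1

/-- Rademacher random variables: `±1` with probability `1/2` each. -/
structure IsRademacher {Ω : Type*} [MeasurableSpace Ω] (X : Ω → ℝ) (μ : Measure Ω) : Prop where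
  measurable : Measurable X
  prob_one : μ {ω | X ω = 1} = 1 / 2
  prob_neg_one : μ {ω | X ω = -1} = 1 / 2

/-- The partial sum `∑_{k ∈ s} ε_k(ω) P_k f`. -/
def partialSum {Ω : Type*} (ψ : Plane → ℝ) (ε : (Fin 2 → ℤ) → Ω → ℝ) (f : L2)
    (s : Finset (Fin 2 → ℤ)) (ω : Ω) : L2 :=
  ∑ k ∈ s, ((ε k ω : ℝ) : ℂ) • unitProj ψ k f

/-- `(Φ₀, Φ₁)` is (a version of) the randomization
`(∑_k ε_k(ω) P_k φ₀, ∑_k ν_k(ω) P_k φ₁)` of `(φ₀, φ₁)`, the sum being the limit in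
`L²(Ω; H¹(ℝ²) × L²(ℝ²))` of the finite partial sums. -/
structure IsRandomization {Ω : Type*} [MeasurableSpace Ω] (μ : Measure Ω) (ψ : Plane → ℝ)
    (ε ν : (Fin 2 → ℤ) → Ω → ℝ) (φ₀ φ₁ : L2) (Φ₀ Φ₁ : Ω → L2) : Prop where
  aestronglyMeasurable_zero : AEStronglyMeasurable Φ₀ μ
  aestronglyMeasurable_one : AEStronglyMeasurable Φ₁ μ
  tendsto : Tendsto
    (fun s : Finset (Fin 2 → ℤ) =>
      ∫⁻ ω, (h1ENorm (partialSum ψ ε φ₀ s ω - Φ₀ ω) ^ 2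
        + ‖partialSum ψ ν φ₁ s ω - Φ₁ ω‖ₑ ^ 2) ∂μ)
    atTop (𝓝 0)

/-- The free wave evolution `cos(t|∇|) f₀ + (sin(t|∇|)/|∇|) f₁`. (At the single frequency `ξ = 0`
the second symbol is `0 / 0 = 0` here instead of `t`, which does not affect the operator.) -/
def freeWave (f₀ f₁ : L2) (t : ℝ) : L2 :=
  fourierMul (fun ξ => (Real.cos (t * absNabla ξ) : ℂ)) f₀
    + fourierMul (fun ξ => ((Real.sin (t * absNabla ξ) / absNabla ξ : ℝ) : ℂ)) f₁

/-- `(v 0, v 1, v 2) = (∂_t u, ∂₁ u, ∂₂ u)` for a curve `u` in `L²(ℝ²)`: the time derivative is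
the derivative of the curve in `L²(ℝ²)`, the spatial derivatives are distributional. -/
structure IsSpacetimeGradient (u : ℝ → L2) (v : Fin 3 → ℝ → L2) : Prop where
  time : ∀ t, HasDerivAt u (v 0 t) t
  space : ∀ (j : Fin 2) (t : ℝ),
    ∂_{(EuclideanSpace.single j (1 : ℝ) : Plane)} ((u t : L2) : 𝓢'(Plane, ℂ))
      = ((v j.succ t : L2) : 𝓢'(Plane, ℂ))

/-- `v` has finite mixed norm `‖v‖_{L^q_t L^r_x(I × ℝ²)}` (the `L^q(I)` norm of
`t ↦ ‖v(t)‖_{L^r(ℝ²)}`, this function of `t` being measurable). -/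
def MemMixedLp (q r : ℝ≥0∞) (I : Set ℝ) (v : ℝ → L2) : Prop :=
  MemLp (fun t => eLpNorm (v t) r (volume : Measure Plane)) q (volume.restrict I)

/-- The functions in `L²` with finite `h1ENorm` are exactly those in the Sobolev space `H¹`. -/
theorem memSobolev_one_iff (f : L2) :
    MemSobolev 1 2 ((f : L2) : 𝓢'(Plane, ℂ)) ↔ h1ENorm f < ∞ := by
  set w : Plane → ℝ := fun x => (1 + ‖x‖ ^ 2) ^ ((1 : ℝ) / 2) with hw
  have hwpos : ∀ x, 0 < w x := fun x => by positivity
  have hws : ∀ x, w x = Real.sqrt (1 + ‖x‖ ^ 2) := fun x => by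
    rw [hw, Real.sqrt_eq_rpow]
  have hgt : (fun x => (w x : ℂ)).HasTemperateGrowth := by
    rw [hw]; fun_prop
  have hmeas : AEStronglyMeasurable ((𝓕 f : L2) : Plane → ℂ) volume := Lp.aestronglyMeasurable _
  have hwc : Continuous w := by
    have : w = fun x => Real.sqrt (1 + ‖x‖ ^ 2) := funext hws
    rw [this]; fun_prop
  have hac : Continuous absNabla := by unfold absNabla; fun_prop
  have hm1 : AEStronglyMeasurable (fun ξ => (w ξ : ℂ) * (𝓕 f : L2) ξ) volume :=
    (Complex.continuous_ofReal.comp hwc).aestronglyMeasurable.mul hmeas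
  have hm2 : AEStronglyMeasurable
      (fun ξ => ((Real.sqrt (1 + absNabla ξ ^ 2) : ℝ) : ℂ) * (𝓕 f : L2) ξ) volume := by
    refine AEStronglyMeasurable.mul (Continuous.aestronglyMeasurable ?_) hmeas
    fun_prop
  have hpi : 1 ≤ 2 * Real.pi := by linarith [Real.pi_gt_three]
  have key : h1ENorm f < ∞ ↔ MemLp (fun ξ => (w ξ : ℂ) * (𝓕 f : L2) ξ) 2 volume := by
    constructor
    · intro h
      refine MemLp.mono ⟨hm2, h⟩ hm1 (Eventually.of_forall fun ξ => ?_)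
      rw [norm_mul, norm_mul, Complex.norm_real, Complex.norm_real, Real.norm_eq_abs,
        Real.norm_eq_abs, abs_of_nonneg (hwpos ξ).le, abs_of_nonneg (Real.sqrt_nonneg _), hws]
      gcongr
      unfold absNabla
      nlinarith [norm_nonneg ξ]
    · intro h
      refine (MemLp.of_le_mul (c := 2 * Real.pi) h hm2 (Eventually.of_forall fun ξ => ?_)).2
      rw [norm_mul, norm_mul, Complex.norm_real, Complex.norm_real, Real.norm_eq_abs,
        Real.norm_eq_abs, abs_of_nonneg (hwpos ξ).le, abs_of_nonneg (Real.sqrt_nonneg _), hws,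
        ← mul_assoc]
      gcongr
      apply Real.sqrt_le_iff.2 ⟨by positivity, ?_⟩
      rw [mul_pow, Real.sq_sqrt (by positivity), absNabla]
      nlinarith [norm_nonneg ξ]
  rw [key, memSobolev_iff_exists_smulLeftCLM_fourier, Lp.fourier_toTemperedDistribution_eq]
  constructor
  · rintro ⟨f', hf'⟩
    have hgi : (fun x : Plane => (((1 + ‖x‖ ^ 2) ^ (-(1 : ℝ) / 2) : ℝ) : ℂ)).HasTemperateGrowth := by
      fun_prop
    have hinv : ∀ x : Plane, (1 + ‖x‖ ^ 2) ^ (-(1 : ℝ) / 2) * w x = 1 := fun x => by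
      rw [hw, ← Real.rpow_add (by positivity)]; norm_num
    have hle : ∀ x : Plane, (1 + ‖x‖ ^ 2) ^ (-(1 : ℝ) / 2) ≤ 1 := fun x =>
      Real.rpow_le_one_of_one_le_of_nonpos (by simp) (by norm_num)
    have hbd : MemLp (fun x : Plane => (((1 + ‖x‖ ^ 2) ^ (-(1 : ℝ) / 2) : ℝ) : ℂ)) ∞ volume := by
      refine memLp_top_of_bound hgi.1.continuous.aestronglyMeasurable 1
        (Eventually.of_forall fun x => ?_)
      rw [Complex.norm_real, Real.norm_eq_abs, abs_of_nonneg (by positivity)]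
      exact hle x
    have h1 := congrArg (TemperedDistribution.smulLeftCLM ℂ
      (fun x : Plane => (((1 + ‖x‖ ^ 2) ^ (-(1 : ℝ) / 2) : ℝ) : ℂ))) hf'
    change smulLeftCLM ℂ _ (smulLeftCLM ℂ (fun x => (w x : ℂ)) _) = _ at h1
    rw [smulLeftCLM_smulLeftCLM_apply hgt hgi,
      ← Lp.toTemperedDistribution_smul_eq (r := 2) hgi hbd f'] at h1
    have h2 : ((fun x => (w x : ℂ)) *
        fun x : Plane => (((1 + ‖x‖ ^ 2) ^ (-(1 : ℝ) / 2) : ℝ) : ℂ)) = fun _ => 1 := by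
      funext x
      simp only [Pi.mul_apply]
      rw [← Complex.ofReal_mul, mul_comm, hinv, Complex.ofReal_one]
    rw [h2, smulLeftCLM_const, one_smul] at h1
    have h3 : (𝓕 f : L2) = hbd.toLp _ • f' := by
      have := Lp.ker_toTemperedDistributionCLM_eq_bot (F := ℂ) (μ := (volume : Measure Plane))
        (p := 2)
      exact LinearMap.ker_eq_bot.1 this h1
    have h4 : (fun ξ => (w ξ : ℂ) * (𝓕 f : L2) ξ) =ᵐ[volume] f' := by
      rw [h3]
      filter_upwards [Lp.coeFn_lpSMul (r := 2) (hbd.toLp _) f', hbd.coeFn_toLp] with x hx hx'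
      rw [hx, Pi.smul_apply', hx', smul_eq_mul, ← mul_assoc, ← Complex.ofReal_mul,
        mul_comm (w x), hinv, Complex.ofReal_one, one_mul]
    exact (memLp_congr_ae h4).2 (Lp.memLp f')
  · intro h
    refine ⟨h.toLp _, ?_⟩
    ext u
    simp only [Lp.toTemperedDistribution_apply, smulLeftCLM_apply_apply]
    apply integral_congr_ae
    filter_upwards [h.coeFn_toLp] with x hx
    rw [hx, SchwartzMap.smulLeftCLM_apply_apply hgt]
    simp only [smul_eq_mul]
    ring

end RandomWave

end

open RandomWave

/-!
A randomized function `f^ω = ∑_k ε_k P_k f` of `f ∈ L²` is better integrable in space than `f`. For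
a bounded multiplier `T` and a point `x`, Khinchine's inequality (`exists_khinchine`) bounds the
`2n`-th moment of `T f^ω(x) = ∑_k ε_k (T P_k f)(x)` by `(∑_k |T P_k f(x)|²)^n`. Each `T P_k f` has
its frequencies in a ball of radius one, so Bernstein's inequality
(`IsUnitCutoff.exists_bernstein`), whose constant is the same for all these balls, bounds
`∑_k |T P_k f(x)|²` by a multiple of `∑_k ‖P_k f‖² ≤ ‖f‖²`, uniformly in `x`. Hence only one factor
of the `n`-th power has to be integrated in `x`, and `E ‖T f^ω‖_{L^{2n}}^{2n} ≲ ‖f‖^{2n}`. This is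
proved for finite partial sums (`exists_lintegral_eLpNorm_partialSum_le`) and passes to the series
by Fatou's lemma, because the `L^p` norm is lower semicontinuous on `L²`.

For a strongly continuous family `T_t` of contractive multipliers, Tonelli's theorem then shows that
`t ↦ ‖T_t f^ω‖_{L^{2n}}` is almost surely in `L^{2n}` on bounded intervals. Interpolation with the
trivial bound in `L²` gives all `2 ≤ r ≤ 2n` and `q ≤ 2n` (`IsRandomSeries.ae_memMixedLp`).

The `H¹` datum is written `φ₀ = (1 + |∇|²)^{-1/2} g` with `g ∈ L²`; randomization commutes with
multipliers, so the randomization of `φ₀` comes from that of `g`. Every component of the gradient of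
the free wave is then a sum `T_t g^ω + S_t φ₁^ω` with symbols of modulus at most one
(`isSpacetimeGradient_freeWave`), to which the above applies. The series converge in `L²(Ω; L²)`
since their terms are orthogonal (`exists_isRandomSeries`), and any version of the randomization
agrees almost surely with the one constructed.
-/

noncomputable section

namespace RandomWave

/-! ### Bounded Fourier multipliers on `L²` -/

section Multiplier

variable {m m' : Plane → ℂ} {C C' : ℝ}

/-- A bounded symbol: a measurable function on the frequency plane with values in the disc of
radius `C`. -/
structure IsBddSymbol (m : Plane → ℂ) (C : ℝ) : Prop where
  measurable : Measurable m
  bound : ∀ ξ, ‖m ξ‖ ≤ C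

lemma IsBddSymbol.nonneg (h : IsBddSymbol m C) : 0 ≤ C := (norm_nonneg _).trans (h.bound 0)

lemma IsBddSymbol.mul (h : IsBddSymbol m C) (h' : IsBddSymbol m' C') :
    IsBddSymbol (fun ξ => m ξ * m' ξ) (C * C') :=
  ⟨h.measurable.mul h'.measurable, fun ξ => by
    rw [norm_mul]; exact mul_le_mul (h.bound ξ) (h'.bound ξ) (norm_nonneg _) h.nonneg⟩

lemma IsBddSymbol.sub (h : IsBddSymbol m C) (h' : IsBddSymbol m' C') :
    IsBddSymbol (fun ξ => m ξ - m' ξ) (C + C') :=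
  ⟨h.measurable.sub h'.measurable, fun ξ =>
    (norm_sub_le _ _).trans (add_le_add (h.bound ξ) (h'.bound ξ))⟩

lemma IsBddSymbol.const_mul (h : IsBddSymbol m C) (c : ℂ) :
    IsBddSymbol (fun ξ => c * m ξ) (‖c‖ * C) :=
  ⟨h.measurable.const_mul c, fun ξ => by
    rw [norm_mul]; exact mul_le_mul_of_nonneg_left (h.bound ξ) (norm_nonneg _)⟩

lemma IsBddSymbol.memLp_mul (h : IsBddSymbol m C) (f : L2) :
    MemLp (fun ξ => m ξ * f ξ) 2 (volume : Measure Plane) := by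
  refine MemLp.of_le_mul (c := C) (Lp.memLp f)
    (h.measurable.aestronglyMeasurable.mul (Lp.aestronglyMeasurable f))
    (Eventually.of_forall fun ξ => ?_)
  rw [norm_mul]
  exact mul_le_mul_of_nonneg_right (h.bound ξ) (norm_nonneg _)

lemma fourier_fourierMul (h : IsBddSymbol m C) (f : L2) :
    ((𝓕 (fourierMul m f) : L2) : Plane → ℂ) =ᵐ[volume] fun ξ => m ξ * (𝓕 f : L2) ξ := by
  have h1 := h.memLp_mul (𝓕 f)
  rw [fourierMul, dif_pos h1, FourierTransform.fourier_fourierInv_eq]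
  exact h1.coeFn_toLp

lemma eq_of_fourier_ae_eq {f g : L2}
    (h : ((𝓕 f : L2) : Plane → ℂ) =ᵐ[volume] ((𝓕 g : L2) : Plane → ℂ)) : f = g := by
  have := congrArg (fun x : L2 => (𝓕⁻ x : L2)) (Lp.ext h)
  simpa using this

lemma fourierMul_add_right (h : IsBddSymbol m C) (f g : L2) :
    fourierMul m (f + g) = fourierMul m f + fourierMul m g := by
  apply eq_of_fourier_ae_eq
  rw [FourierTransform.fourier_add]
  filter_upwards [fourier_fourierMul h (f + g), fourier_fourierMul h f, fourier_fourierMul h g,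
    Lp.coeFn_add (𝓕 (fourierMul m f) : L2) (𝓕 (fourierMul m g)),
    Lp.coeFn_add (𝓕 f : L2) (𝓕 g)] with ξ h1 h2 h3 h4 h5
  rw [h1, h4, Pi.add_apply, h2, h3, FourierTransform.fourier_add, h5, Pi.add_apply, mul_add]

lemma fourierMul_smul_right (h : IsBddSymbol m C) (c : ℂ) (f : L2) :
    fourierMul m (c • f) = c • fourierMul m f := by
  apply eq_of_fourier_ae_eq
  rw [FourierTransform.fourier_smul]
  filter_upwards [fourier_fourierMul h (c • f), fourier_fourierMul h f,
    Lp.coeFn_smul c (𝓕 (fourierMul m f) : L2), Lp.coeFn_smul c (𝓕 f : L2)] with ξ h1 h2 h3 h4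
  rw [h1, h3, Pi.smul_apply, h2, FourierTransform.fourier_smul, h4, Pi.smul_apply,
    smul_eq_mul, smul_eq_mul, mul_left_comm]

lemma enorm_sq_eq_lintegral (f : L2) : ‖f‖ₑ ^ 2 = ∫⁻ x, ‖f x‖ₑ ^ 2 := by
  rw [Lp.enorm_def]
  have := eLpNorm_nnreal_pow_eq_lintegral (f := (f : Plane → ℂ)) (μ := volume)
    (p := 2) two_ne_zero
  simpa using this

lemma enorm_fourier (f : L2) : ‖(𝓕 f : L2)‖ₑ = ‖f‖ₑ := by
  rw [← ofReal_norm, ← ofReal_norm, Lp.norm_fourier_eq]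

/-- Plancherel's identity for a multiplier. -/
lemma enorm_fourierMul_sq (h : IsBddSymbol m C) (f : L2) :
    ‖fourierMul m f‖ₑ ^ 2 = ∫⁻ ξ, ‖m ξ‖ₑ ^ 2 * ‖(𝓕 f : L2) ξ‖ₑ ^ 2 := by
  rw [← enorm_fourier, enorm_sq_eq_lintegral]
  apply lintegral_congr_ae
  filter_upwards [fourier_fourierMul h f] with ξ hξ
  rw [hξ, enorm_mul, mul_pow]

lemma norm_fourierMul_le (h : IsBddSymbol m C) (f : L2) : ‖fourierMul m f‖ ≤ C * ‖f‖ := by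
  rw [← Lp.norm_fourier_eq, ← Lp.norm_fourier_eq f]
  apply Lp.norm_le_mul_norm_of_ae_le_mul
  filter_upwards [fourier_fourierMul h f] with ξ hξ
  rw [hξ, norm_mul]
  exact mul_le_mul_of_nonneg_right (h.bound ξ) (norm_nonneg _)

/-- A bounded multiplier as a continuous linear map. -/
def mulCLM (h : IsBddSymbol m C) : L2 →L[ℂ] L2 :=
  LinearMap.mkContinuous
    { toFun := fourierMul m
      map_add' := fourierMul_add_right h
      map_smul' := fourierMul_smul_right h } C (norm_fourierMul_le h)

@[simp] lemma mulCLM_apply (h : IsBddSymbol m C) (f : L2) : mulCLM h f = fourierMul m f := rfl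

lemma fourierMul_fourierMul (h : IsBddSymbol m C) (h' : IsBddSymbol m' C') (f : L2) :
    fourierMul m (fourierMul m' f) = fourierMul (fun ξ => m ξ * m' ξ) f := by
  apply eq_of_fourier_ae_eq
  filter_upwards [fourier_fourierMul h (fourierMul m' f), fourier_fourierMul h' f,
    fourier_fourierMul (h.mul h') f] with ξ h1 h2 h3
  rw [h1, h2, h3, mul_assoc]

lemma fourierMul_sub_left (h : IsBddSymbol m C) (h' : IsBddSymbol m' C') (f : L2) :
    fourierMul (fun ξ => m ξ - m' ξ) f = fourierMul m f - fourierMul m' f := by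
  apply eq_of_fourier_ae_eq
  have hs : (𝓕 (fourierMul m f - fourierMul m' f) : L2)
      = 𝓕 (fourierMul m f) - 𝓕 (fourierMul m' f) :=
    (Lp.fourierTransformₗᵢ Plane ℂ).map_sub _ _
  rw [hs]
  filter_upwards [fourier_fourierMul h f, fourier_fourierMul h' f,
    fourier_fourierMul (h.sub h') f,
    Lp.coeFn_sub (𝓕 (fourierMul m f) : L2) (𝓕 (fourierMul m' f))] with ξ h1 h2 h3 h4
  rw [h3, h4, Pi.sub_apply, h1, h2, sub_mul]

lemma fourierMul_const_mul_left (h : IsBddSymbol m C) (c : ℂ) (f : L2) :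
    fourierMul (fun ξ => c * m ξ) f = c • fourierMul m f := by
  apply eq_of_fourier_ae_eq
  rw [FourierTransform.fourier_smul]
  filter_upwards [fourier_fourierMul h f, fourier_fourierMul (h.const_mul c) f,
    Lp.coeFn_smul c (𝓕 (fourierMul m f) : L2)] with ξ h1 h2 h3
  rw [h2, h3, Pi.smul_apply, h1, smul_eq_mul, mul_assoc]

/-- Uniformly bounded symbols that converge almost everywhere give multipliers that converge
strongly: dominated convergence on the Fourier side. -/
lemma tendsto_fourierMul {ι : Type*} {l : Filter ι} [l.IsCountablyGenerated]
    {M : ι → Plane → ℂ} (hM : ∀ i, IsBddSymbol (M i) C) (hm : IsBddSymbol m C')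
    (hlim : ∀ᵐ ξ, Tendsto (fun i => M i ξ) l (𝓝 (m ξ))) (f : L2) :
    Tendsto (fun i => fourierMul (M i) f) l (𝓝 (fourierMul m f)) := by
  rw [tendsto_iff_edist_tendsto_0]
  have hsq : Tendsto (fun i => edist (fourierMul (M i) f) (fourierMul m f) ^ 2) l (𝓝 0) := by
    have h1 : ∀ i, edist (fourierMul (M i) f) (fourierMul m f) ^ 2
        = ∫⁻ ξ, ‖M i ξ - m ξ‖ₑ ^ 2 * ‖(𝓕 f : L2) ξ‖ₑ ^ 2 := fun i => by
      rw [edist_eq_enorm_sub, ← fourierMul_sub_left (hM i) hm,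
        enorm_fourierMul_sq ((hM i).sub hm)]
    simp only [h1]
    have h2 : ∫⁻ _ : Plane, (0 : ℝ≥0∞) = 0 := lintegral_zero
    rw [← h2]
    have hf : Measurable fun ξ => ‖(𝓕 f : L2) ξ‖ₑ ^ 2 :=
      ((Lp.stronglyMeasurable (𝓕 f : L2)).enorm).pow_const 2
    refine tendsto_lintegral_filter_of_dominated_convergence
      (fun ξ => ENNReal.ofReal (C + C') ^ 2 * ‖(𝓕 f : L2) ξ‖ₑ ^ 2) ?_ ?_ ?_ ?_
    · exact Eventually.of_forall fun i =>
        ((((hM i).sub hm).measurable.enorm).pow_const 2).mul hf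
    · refine Eventually.of_forall fun i => Eventually.of_forall fun ξ => ?_
      gcongr
      rw [← ofReal_norm]
      exact ENNReal.ofReal_le_ofReal (((hM i).sub hm).bound ξ)
    · rw [lintegral_const_mul _ hf, ← enorm_sq_eq_lintegral]
      finiteness
    · filter_upwards [hlim] with ξ hξ
      have h3 : Tendsto (fun i => ‖M i ξ - m ξ‖ₑ) l (𝓝 0) := by
        have := (tendsto_iff_edist_tendsto_0.1 hξ)
        simpa only [edist_eq_enorm_sub] using this
      have h4 := ENNReal.Tendsto.mul_const (b := ‖(𝓕 f : L2) ξ‖ₑ ^ 2)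
        (ENNReal.Tendsto.pow (n := 2) h3) (Or.inr (ENNReal.pow_ne_top enorm_ne_top))
      simpa using h4
  have := hsq.ennrpow_const (1 / 2)
  simp only [one_div, ENNReal.zero_rpow_of_pos (show (0 : ℝ) < 2⁻¹ by norm_num)] at this
  refine this.congr fun i => ?_
  rw [← ENNReal.rpow_natCast, ← ENNReal.rpow_mul]
  norm_num

end Multiplier

/-! ### `L^p` norms of elements of `L²` -/

lemma lowerSemicontinuous_eLpNorm (p : ℝ≥0∞) :
    LowerSemicontinuous fun f : L2 => eLpNorm f p (volume : Measure Plane) := by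
  rw [lowerSemicontinuous_iff_isClosed_preimage]
  intro c
  refine IsSeqClosed.isClosed fun u f hu hf => ?_
  exact eLpNorm_le_of_tendstoInMeasure (Eventually.of_forall hu)
    (tendstoInMeasure_of_tendsto_Lp hf) fun i => Lp.aestronglyMeasurable _

/-- Interpolation of `L^r` between `L²` and `L^p`. -/
lemma eLpNorm_le_two_mul_add {α : Type*} [MeasurableSpace α] {ρ : Measure α} {f : α → ℂ}
    (hf : AEStronglyMeasurable f ρ) {p r : ℝ} (hr : 2 ≤ r) (hrp : r ≤ p) :
    eLpNorm f (ENNReal.ofReal r) ρ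
      ≤ 2 * (eLpNorm f 2 ρ + eLpNorm f (ENNReal.ofReal p) ρ) := by
  have hr0 : 0 < r := by linarith
  have hp0 : 0 < p := by linarith
  set N := eLpNorm f 2 ρ + eLpNorm f (ENNReal.ofReal p) ρ with hN
  rcases eq_or_ne N ∞ with hNt | hNt
  · rw [hNt]; simp
  rcases eq_or_ne N 0 with hN0 | hN0
  · have h0 : eLpNorm f 2 ρ = 0 := by
      rw [hN] at hN0; exact (add_eq_zero.1 hN0).1
    rw [eLpNorm_eq_zero_iff hf two_ne_zero] at h0
    rw [eLpNorm_congr_ae h0]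
    simp
  have key : ∀ s : ℝ, 0 < s → ∀ g : α → ℂ, eLpNorm g (ENNReal.ofReal s) ρ ^ s
      = ∫⁻ x, ‖g x‖ₑ ^ s ∂ρ := fun s hs g => by
    have := eLpNorm_nnreal_pow_eq_lintegral (f := g) (μ := ρ) (p := s.toNNReal)
      (by simpa using hs)
    rw [Real.coe_toNNReal _ hs.le] at this
    exact this
  have h2 : (2 : ℝ≥0∞) = ENNReal.ofReal 2 := by simp
  -- split according to whether `|f|` is below or above the level `N`; this makes both terms
  -- homogeneous of degree `r`
  have hpt : ∀ x, ‖f x‖ₑ ^ r ≤ N ^ (r - 2) * ‖f x‖ₑ ^ (2 : ℝ) + N ^ (r - p) * ‖f x‖ₑ ^ p := by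
    intro x
    rcases le_total ‖f x‖ₑ N with hx | hx
    · refine le_add_right ?_
      calc ‖f x‖ₑ ^ r = ‖f x‖ₑ ^ (r - 2) * ‖f x‖ₑ ^ (2 : ℝ) := by
            rw [← ENNReal.rpow_add_of_nonneg _ _ (by linarith) (by norm_num)]; congr 1; ring
        _ ≤ _ := by gcongr
    · refine le_add_left ?_
      have hx0 : ‖f x‖ₑ ≠ 0 := fun h => hN0 (by simpa [h] using hx)
      calc ‖f x‖ₑ ^ r = ‖f x‖ₑ ^ (r - p) * ‖f x‖ₑ ^ p := by
            rw [← ENNReal.rpow_add _ _ hx0 enorm_ne_top]; congr 1; ring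
        _ ≤ _ := by
            gcongr ?_ * _
            rw [← neg_sub p r, ENNReal.rpow_neg, ENNReal.rpow_neg]
            exact ENNReal.inv_le_inv.2 (ENNReal.rpow_le_rpow hx (by linarith))
  have hm : ∀ s : ℝ, AEMeasurable (fun x => ‖f x‖ₑ ^ s) ρ := fun s => hf.enorm.pow_const s
  have hmain : eLpNorm f (ENNReal.ofReal r) ρ ^ r ≤ (2 * N) ^ r := by
    rw [key r hr0]
    calc ∫⁻ x, ‖f x‖ₑ ^ r ∂ρ
        ≤ ∫⁻ x, (N ^ (r - 2) * ‖f x‖ₑ ^ (2 : ℝ) + N ^ (r - p) * ‖f x‖ₑ ^ p) ∂ρ :=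
          lintegral_mono hpt
      _ = N ^ (r - 2) * eLpNorm f 2 ρ ^ (2 : ℝ)
          + N ^ (r - p) * eLpNorm f (ENNReal.ofReal p) ρ ^ p := by
          rw [lintegral_add_left' ((hm 2).const_mul _), lintegral_const_mul'' _ (hm 2),
            lintegral_const_mul'' _ (hm p), key p hp0, h2, key 2 two_pos]
      _ ≤ N ^ (r - 2) * N ^ (2 : ℝ) + N ^ (r - p) * N ^ p := by
          gcongr
          · exact le_self_add
          · exact le_add_self
      _ = 2 * N ^ r := by
          rw [← ENNReal.rpow_add _ _ hN0 hNt, ← ENNReal.rpow_add _ _ hN0 hNt]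
          ring_nf
      _ ≤ 2 ^ r * N ^ r := by
          gcongr
          conv_lhs => rw [← ENNReal.rpow_one 2]
          exact ENNReal.rpow_le_rpow_of_exponent_le (by norm_num) (by linarith)
      _ = (2 * N) ^ r := (ENNReal.mul_rpow_of_nonneg _ _ hr0.le).symm
  exact (ENNReal.rpow_le_rpow_iff hr0).1 hmain

/-! ### Bernstein's inequality for the unit-scale projections -/

section Bernstein

variable {ψ : Plane → ℝ}

lemma isBddSymbol_schwartz (χ : 𝓢(Plane, ℂ)) :
    IsBddSymbol χ (SchwartzMap.seminorm ℝ 0 0 χ) :=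
  ⟨χ.continuous.measurable, χ.norm_le_seminorm ℝ⟩

/-- For Schwartz functions this is the trivial bound `‖𝓕⁻ g‖_∞ ≤ ‖g‖₁` and the Cauchy–Schwarz
inequality; both sides pass to limits in `L²`, the left one by lower semicontinuity. -/
lemma eLpNorm_top_fourierMul_schwartz_le (χ : 𝓢(Plane, ℂ)) (f : L2) :
    eLpNorm (fourierMul χ f) ∞ (volume : Measure Plane) ≤ eLpNorm χ 2 volume * ‖f‖ₑ := by
  have hχ := isBddSymbol_schwartz χ
  refine DenseRange.induction_on
    (p := fun f : L2 => eLpNorm (fourierMul χ f) ∞ (volume : Measure Plane)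
      ≤ eLpNorm χ 2 volume * ‖f‖ₑ)
    (SchwartzMap.denseRange_toLpCLM (p := 2) ENNReal.ofNat_ne_top) f ?_ fun S => ?_
  · have h1 : LowerSemicontinuous fun f : L2 =>
        eLpNorm (fourierMul χ f) ∞ (volume : Measure Plane) :=
      (lowerSemicontinuous_eLpNorm ∞).comp (mulCLM hχ).continuous
    have h2 : Continuous fun f : L2 => (f, eLpNorm χ 2 (volume : Measure Plane) * ‖f‖ₑ) :=
      continuous_id.prodMk
        ((ENNReal.continuous_const_mul (χ.memLp 2 volume).2.ne).comp continuous_enorm)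
    exact h1.isClosed_epigraph.preimage h2
  · rw [SchwartzMap.toLpCLM_apply]
    have h1 : fourierMul χ (S.toLp 2)
        = (𝓕⁻ (SchwartzMap.smulLeftCLM ℂ χ (𝓕 S)) : 𝓢(Plane, ℂ)).toLp 2 := by
      apply eq_of_fourier_ae_eq
      rw [SchwartzMap.toLp_fourier_eq, FourierTransform.fourier_fourierInv_eq]
      filter_upwards [fourier_fourierMul hχ (S.toLp 2),
        SchwartzMap.coeFn_toLp (SchwartzMap.smulLeftCLM ℂ χ (𝓕 S)) 2,
        SchwartzMap.coeFn_toLp (𝓕 S) 2] with ξ h1 h2 h3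
      rw [h1, h2, SchwartzMap.toLp_fourier_eq, h3,
        SchwartzMap.smulLeftCLM_apply_apply χ.hasTemperateGrowth, smul_eq_mul]
    rw [h1, eLpNorm_congr_ae (SchwartzMap.coeFn_toLp _ _ volume)]
    have h2 : ‖(S.toLp 2 : L2)‖ₑ = eLpNorm (𝓕 S : 𝓢(Plane, ℂ)) 2 volume := by
      rw [← enorm_fourier, SchwartzMap.toLp_fourier_eq, Lp.enorm_def,
        eLpNorm_congr_ae (SchwartzMap.coeFn_toLp _ _ volume)]
    rw [h2]
    have h3 : eLpNorm ((χ : Plane → ℂ) • ((𝓕 S : 𝓢(Plane, ℂ)) : Plane → ℂ)) 1 volume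
        ≤ eLpNorm χ 2 volume * eLpNorm (𝓕 S : 𝓢(Plane, ℂ)) 2 volume :=
      eLpNorm_smul_le_mul_eLpNorm (𝓕 S : 𝓢(Plane, ℂ)).continuous.aestronglyMeasurable
        χ.continuous.aestronglyMeasurable
    refine le_trans ?_ h3
    rw [eLpNorm_exponent_top]
    refine essSup_le_of_ae_le _ (Eventually.of_forall fun x => ?_)
    beta_reduce
    rw [SchwartzMap.fourierInv_coe, Real.fourierInv_eq, eLpNorm_one_eq_lintegral_enorm]
    refine (enorm_integral_le_lintegral_enorm _).trans (lintegral_mono fun ξ => ?_)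
    rw [SchwartzMap.smulLeftCLM_apply_apply χ.hasTemperateGrowth, ← ofReal_norm,
      Circle.norm_smul, ofReal_norm]
    rfl

lemma IsUnitCutoff.le_one (hψ : IsUnitCutoff ψ) (ξ : Plane) : ψ ξ ≤ 1 := by
  have h := hψ.hasSum_one ξ
  have := le_hasSum h 0 fun k _ => hψ.nonneg _
  have h0 : latticePoint 0 = 0 := by ext i; simp [latticePoint]
  simpa [h0] using this

lemma IsUnitCutoff.isBddSymbol (hψ : IsUnitCutoff ψ) (k : Fin 2 → ℤ) :
    IsBddSymbol (fun ξ => (ψ (ξ - latticePoint k) : ℂ)) 1 := by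
  refine ⟨?_, fun ξ => ?_⟩
  · have := hψ.contDiff.continuous
    fun_prop
  · rw [Complex.norm_real, Real.norm_eq_abs, abs_of_nonneg (hψ.nonneg _)]
    exact hψ.le_one _

/-- Bernstein's inequality on the frequency balls of radius `1` around the lattice points: the
constant does not depend on the ball, by translation invariance on the frequency side. -/
lemma IsUnitCutoff.exists_bernstein (hψ : IsUnitCutoff ψ) :
    ∃ K : ℝ≥0∞, K ≠ ∞ ∧ ∀ (k : Fin 2 → ℤ) (m : Plane → ℂ), IsBddSymbol m 1 → ∀ f : L2,
      eLpNorm (fourierMul m (unitProj ψ k f)) ∞ (volume : Measure Plane)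
        ≤ K * ‖unitProj ψ k f‖ₑ := by
  let g : ContDiffBump (0 : Plane) := ⟨1, 2, one_pos, one_lt_two⟩
  have hgc : Continuous fun ξ => ((g ξ : ℝ) : ℂ) := Complex.continuous_ofReal.comp g.continuous
  have hgs : HasCompactSupport fun ξ => ((g ξ : ℝ) : ℂ) :=
    g.hasCompactSupport.comp_left Complex.ofReal_zero
  refine ⟨eLpNorm (fun ξ => ((g ξ : ℝ) : ℂ)) 2 volume,
    (hgc.memLp_of_hasCompactSupport hgs).2.ne, fun k m hm f => ?_⟩
  have hs : HasCompactSupport fun ξ => ((g (ξ - latticePoint k) : ℝ) : ℂ) :=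
    hgs.comp_homeomorph (Homeomorph.subRight (latticePoint k))
  have hd : ContDiff ℝ ((⊤ : ℕ∞) : WithTop ℕ∞) fun ξ => ((g (ξ - latticePoint k) : ℝ) : ℂ) :=
    Complex.ofRealCLM.contDiff.comp (g.contDiff.comp (contDiff_id.sub contDiff_const))
  let χ : 𝓢(Plane, ℂ) := hs.toSchwartzMap hd
  have hχv : ∀ ξ, χ ξ = ((g (ξ - latticePoint k) : ℝ) : ℂ) := fun ξ => rfl
  have hχ := isBddSymbol_schwartz χ
  have hn : eLpNorm χ 2 (volume : Measure Plane)
      = eLpNorm (fun ξ => ((g ξ : ℝ) : ℂ)) 2 volume :=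
    eLpNorm_comp_measurePreserving hgc.aestronglyMeasurable
      (measurePreserving_sub_right volume (latticePoint k))
  have hk := hψ.isBddSymbol k
  -- `χ` equals one on the frequency support of `P_k f`, so it can be inserted freely
  have hEq : fourierMul m (unitProj ψ k f) = fourierMul χ (fourierMul m (unitProj ψ k f)) := by
    unfold unitProj
    rw [fourierMul_fourierMul hm hk, fourierMul_fourierMul hχ (hm.mul hk)]
    congr 1
    funext ξ
    rcases eq_or_ne (ψ (ξ - latticePoint k)) 0 with h0 | h0
    · simp [h0]
    · have h1 : ξ - latticePoint k ∈ Metric.closedBall (0 : Plane) 1 :=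
        hψ.support (subset_tsupport _ h0)
      rw [hχv, g.one_of_mem_closedBall h1]
      simp
  rw [hEq, ← hn]
  refine (eLpNorm_top_fourierMul_schwartz_le χ _).trans ?_
  gcongr
  rw [← ofReal_norm, ← ofReal_norm]
  refine ENNReal.ofReal_le_ofReal ?_
  simpa using norm_fourierMul_le hm (unitProj ψ k f)

/-- The projections are almost orthogonal: `∑_k ψ(ξ - k)² ≤ 1`. -/
lemma IsUnitCutoff.sum_enorm_unitProj_sq_le (hψ : IsUnitCutoff ψ) (f : L2)
    (s : Finset (Fin 2 → ℤ)) : ∑ k ∈ s, ‖unitProj ψ k f‖ₑ ^ 2 ≤ ‖f‖ₑ ^ 2 := by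
  have h1 : ∀ k, ‖unitProj ψ k f‖ₑ ^ 2
      = ∫⁻ ξ, ‖(ψ (ξ - latticePoint k) : ℂ)‖ₑ ^ 2 * ‖(𝓕 f : L2) ξ‖ₑ ^ 2 := fun k =>
    enorm_fourierMul_sq (hψ.isBddSymbol k) f
  simp only [h1]
  have hm : ∀ k ∈ s, Measurable fun ξ =>
      ‖(ψ (ξ - latticePoint k) : ℂ)‖ₑ ^ 2 * ‖(𝓕 f : L2) ξ‖ₑ ^ 2 := fun k _ =>
    (((hψ.isBddSymbol k).measurable.enorm).pow_const 2).mul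
      ((Lp.stronglyMeasurable (𝓕 f : L2)).enorm.pow_const 2)
  rw [← lintegral_finsetSum _ hm, ← enorm_fourier f, enorm_sq_eq_lintegral]
  refine lintegral_mono fun ξ => ?_
  rw [← Finset.sum_mul]
  refine mul_le_of_le_one_left zero_le ?_
  have h2 : ∀ k, ‖(ψ (ξ - latticePoint k) : ℂ)‖ₑ ^ 2
      ≤ ENNReal.ofReal (ψ (ξ - latticePoint k)) := fun k => by
    rw [← ofReal_norm, Complex.norm_real, Real.norm_eq_abs, abs_of_nonneg (hψ.nonneg _),
      ← ENNReal.ofReal_pow (hψ.nonneg _)]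
    refine ENNReal.ofReal_le_ofReal ?_
    nlinarith [hψ.nonneg (ξ - latticePoint k), hψ.le_one (ξ - latticePoint k)]
  refine (Finset.sum_le_sum fun k _ => h2 k).trans ?_
  rw [← ENNReal.ofReal_sum_of_nonneg fun k _ => hψ.nonneg _]
  exact ENNReal.ofReal_le_one.2 (sum_le_hasSum s (fun k _ => hψ.nonneg _) (hψ.hasSum_one ξ))

end Bernstein

/-! ### Khinchine's inequality -/

section Khinchine

variable {Ω : Type*} [MeasurableSpace Ω] {μ : Measure Ω} [IsProbabilityMeasure μ]

lemma IsRademacher.ae_eq_or {X : Ω → ℝ} (hX : IsRademacher X μ) :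
    ∀ᵐ ω ∂μ, X ω = 1 ∨ X ω = -1 := by
  have hm1 : MeasurableSet {ω | X ω = 1} := hX.measurable (measurableSet_singleton 1)
  have hm2 : MeasurableSet {ω | X ω = -1} := hX.measurable (measurableSet_singleton (-1))
  have hdisj : Disjoint {ω | X ω = 1} {ω | X ω = -1} := by
    rw [Set.disjoint_left]
    intro ω (h1 : X ω = 1) (h2 : X ω = -1)
    linarith
  have h : μ ({ω | X ω = 1} ∪ {ω | X ω = -1}) = 1 := by
    rw [measure_union hdisj hm2, hX.prob_one, hX.prob_neg_one, ENNReal.add_halves]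
  exact (prob_compl_eq_zero_iff (hm1.union hm2)).2 h

lemma IsRademacher.integral_eq_zero {X : Ω → ℝ} (hX : IsRademacher X μ) : μ[X] = 0 := by
  have hm1 : MeasurableSet {ω | X ω = 1} := hX.measurable (measurableSet_singleton 1)
  have h : X =ᵐ[μ] fun ω => {ω | X ω = 1}.indicator (fun _ => (2 : ℝ)) ω - 1 := by
    filter_upwards [hX.ae_eq_or] with ω hω
    rcases hω with h1 | h1
    · rw [Set.indicator_of_mem (show ω ∈ {ω | X ω = 1} from h1), h1]; norm_num
    · rw [Set.indicator_of_notMem, h1]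
      · norm_num
      · intro (h2 : X ω = 1); linarith
  rw [integral_congr_ae h, integral_sub ((integrable_const _).indicator hm1) (integrable_const _),
    integral_indicator_const _ hm1, measureReal_def, hX.prob_one]
  simp

lemma IsRademacher.hasSubgaussianMGF {X : Ω → ℝ} (hX : IsRademacher X μ) :
    HasSubgaussianMGF X 1 μ := by
  have h := hasSubgaussianMGF_of_mem_Icc_of_integral_eq_zero (a := -1) (b := 1)
    hX.measurable.aemeasurable (hX.ae_eq_or.mono fun ω hω => by
      rcases hω with h1 | h1 <;> rw [h1] <;> norm_num) hX.integral_eq_zero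
  convert h
  have : ‖(1 : ℝ) - -1‖₊ = 2 := by
    rw [← NNReal.coe_inj]; norm_num
  rw [this]
  norm_num

/-- Even moments of a sub-Gaussian variable, from `y ^ (2n) / (2n)! ≤ exp y + exp (-y)`. -/
lemma lintegral_pow_le_of_hasSubgaussianMGF {X : Ω → ℝ} {c : ℝ≥0} (hX : HasSubgaussianMGF X c μ)
    (n : ℕ) : ∫⁻ ω, ENNReal.ofReal (X ω ^ (2 * n)) ∂μ
      ≤ ENNReal.ofReal ((2 * n).factorial * (2 * Real.exp (1 / 2)) * (c : ℝ) ^ n) := by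
  have hf0 : (0 : ℝ) < (2 * n).factorial := by positivity
  have hpw : ∀ y : ℝ, y ^ (2 * n) ≤ (2 * n).factorial * (Real.exp y + Real.exp (-y)) := fun y => by
    have h1 := Real.pow_div_factorial_le_exp |y| (abs_nonneg y) (2 * n)
    rw [pow_mul, sq_abs, ← pow_mul, div_le_iff₀ hf0] at h1
    have h2 : Real.exp |y| ≤ Real.exp y + Real.exp (-y) := by
      rcases abs_cases y with ⟨h, _⟩ | ⟨h, _⟩ <;> rw [h] <;>
        linarith [Real.exp_pos y, Real.exp_pos (-y)]
    calc y ^ (2 * n) ≤ Real.exp |y| * (2 * n).factorial := h1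
      _ ≤ _ := by rw [mul_comm]; gcongr
  rcases eq_or_ne c 0 with hc | hc
  · subst hc
    have h0 := hX.ae_eq_zero_of_hasSubgaussianMGF_zero
    rcases Nat.eq_zero_or_pos n with hn | hn
    · subst hn
      simp only [mul_zero, pow_zero, ENNReal.ofReal_one, lintegral_one, measure_univ,
        Nat.factorial_zero, Nat.cast_one, one_mul, mul_one]
      rw [ENNReal.one_le_ofReal]
      linarith [Real.add_one_le_exp (1 / 2 : ℝ)]
    · rw [lintegral_congr_ae (g := fun _ => 0)]
      · simp
      · filter_upwards [h0] with ω hω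
        rw [hω]
        simp [hn.ne']
  -- the exponential moment is used at `t = c ^ (-1/2)`, which normalizes the variance
  have hc0 : (0 : ℝ) < c := by positivity
  set t : ℝ := (Real.sqrt c)⁻¹ with ht
  have ht2 : t ^ 2 = (c : ℝ)⁻¹ := by rw [ht, inv_pow, Real.sq_sqrt hc0.le]
  have hI1 := hX.integrable_exp_mul t
  have hI2 := hX.integrable_exp_mul (-t)
  have hpt : ∀ ω, X ω ^ (2 * n)
      ≤ (c : ℝ) ^ n * (2 * n).factorial * (Real.exp (t * X ω) + Real.exp (-t * X ω)) := fun ω => by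
    have h1 := hpw (t * X ω)
    rw [mul_pow, pow_mul t, ht2] at h1
    have h2 : X ω ^ (2 * n) = (c : ℝ) ^ n * (((c : ℝ)⁻¹) ^ n * X ω ^ (2 * n)) := by
      rw [← mul_assoc, ← mul_pow, mul_inv_cancel₀ hc0.ne', one_pow, one_mul]
    rw [h2, mul_assoc, neg_mul]
    gcongr
  have hint : Integrable (fun ω =>
      (c : ℝ) ^ n * (2 * n).factorial * (Real.exp (t * X ω) + Real.exp (-t * X ω))) μ :=
    (hI1.add hI2).const_mul _
  refine (lintegral_mono fun ω => ENNReal.ofReal_le_ofReal (hpt ω)).trans ?_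
  rw [← ofReal_integral_eq_lintegral_ofReal hint (Eventually.of_forall fun ω => by positivity)]
  refine ENNReal.ofReal_le_ofReal ?_
  rw [integral_const_mul, integral_add hI1 hI2]
  have h1 := hX.mgf_le t
  have h2 := hX.mgf_le (-t)
  rw [neg_sq, ht2, mul_inv_cancel₀ hc0.ne'] at h2
  rw [ht2, mul_inv_cancel₀ hc0.ne'] at h1
  unfold mgf at h1 h2
  calc _ ≤ (c : ℝ) ^ n * (2 * n).factorial * (Real.exp (1 / 2) + Real.exp (1 / 2)) := by gcongr
    _ = _ := by ring

lemma lintegral_rademacher_sum_pow_le {ι : Type*} {ε : ι → Ω → ℝ}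
    (hε : ∀ k, IsRademacher (ε k) μ) (hind : iIndepFun ε μ) (n : ℕ) (s : Finset ι) (a : ι → ℝ) :
    ∫⁻ ω, ENNReal.ofReal ((∑ k ∈ s, a k * ε k ω) ^ (2 * n)) ∂μ
      ≤ ENNReal.ofReal ((2 * n).factorial * (2 * Real.exp (1 / 2)) * (∑ k ∈ s, a k ^ 2) ^ n) := by
  have h1 : iIndepFun (fun k ω => a k * ε k ω) μ :=
    hind.comp (fun k x => a k * x) fun k => measurable_const_mul _
  have h2 := HasSubgaussianMGF.sum_of_iIndepFun h1 (s := s) fun k _ =>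
    (hε k).hasSubgaussianMGF.const_mul (a k)
  refine (lintegral_pow_le_of_hasSubgaussianMGF h2 n).trans_eq ?_
  congr 3
  rw [NNReal.coe_sum]
  exact Finset.sum_congr rfl fun k _ => mul_one (a k ^ 2)

/-- Khinchine's inequality for complex coefficients and even exponents. -/
lemma exists_khinchine {ι : Type*} {ε : ι → Ω → ℝ}
    (hε : ∀ k, IsRademacher (ε k) μ) (hind : iIndepFun ε μ) (n : ℕ) :
    ∃ K : ℝ≥0∞, K ≠ ∞ ∧ ∀ (s : Finset ι) (z : ι → ℂ),
      ∫⁻ ω, ‖∑ k ∈ s, ((ε k ω : ℝ) : ℂ) * z k‖ₑ ^ (2 * n) ∂μ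
        ≤ K * (∑ k ∈ s, ‖z k‖ₑ ^ 2) ^ n := by
  set K₀ : ℝ := (2 * n).factorial * (2 * Real.exp (1 / 2)) with hK₀
  have hK₀' : 0 ≤ K₀ := by positivity
  refine ⟨ENNReal.ofReal (2 ^ (n - 1) * (2 * K₀)), ENNReal.ofReal_ne_top, fun s z => ?_⟩
  set σ : ℝ := ∑ k ∈ s, ‖z k‖ ^ 2 with hσ
  have hσ' : ENNReal.ofReal σ = ∑ k ∈ s, ‖z k‖ₑ ^ 2 := by
    rw [hσ, ENNReal.ofReal_sum_of_nonneg fun _ _ => by positivity]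
    refine Finset.sum_congr rfl fun k _ => ?_
    rw [ENNReal.ofReal_pow (norm_nonneg _), ofReal_norm]
  have hσ0 : 0 ≤ σ := Finset.sum_nonneg fun _ _ => by positivity
  have hre : ∑ k ∈ s, (z k).re ^ 2 ≤ σ := Finset.sum_le_sum fun k _ => by
    rw [← sq_abs]; gcongr; exact Complex.abs_re_le_norm _
  have him : ∑ k ∈ s, (z k).im ^ 2 ≤ σ := Finset.sum_le_sum fun k _ => by
    rw [← sq_abs]; gcongr; exact Complex.abs_im_le_norm _
  set A : Ω → ℝ := fun ω => ∑ k ∈ s, (z k).re * ε k ω with hA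
  set B : Ω → ℝ := fun ω => ∑ k ∈ s, (z k).im * ε k ω with hB
  have hmA : Measurable A := Finset.measurable_sum _ fun k _ => (hε k).measurable.const_mul _
  have hmB : Measurable B := Finset.measurable_sum _ fun k _ => (hε k).measurable.const_mul _
  have hpt : ∀ ω, ‖∑ k ∈ s, ((ε k ω : ℝ) : ℂ) * z k‖ₑ ^ (2 * n)
      ≤ ENNReal.ofReal (2 ^ (n - 1)) *
        (ENNReal.ofReal (A ω ^ (2 * n)) + ENNReal.ofReal (B ω ^ (2 * n))) := fun ω => by
    have h1 : ‖∑ k ∈ s, ((ε k ω : ℝ) : ℂ) * z k‖ ^ 2 = A ω ^ 2 + B ω ^ 2 := by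
      rw [Complex.sq_norm, Complex.normSq_apply]
      simp [hA, hB, mul_comm, sq]
    have hAe : 0 ≤ A ω ^ (2 * n) := by rw [pow_mul]; positivity
    have hBe : 0 ≤ B ω ^ (2 * n) := by rw [pow_mul]; positivity
    rw [← ofReal_norm, ← ENNReal.ofReal_pow (norm_nonneg _), pow_mul, h1,
      ← ENNReal.ofReal_add hAe hBe, ← ENNReal.ofReal_mul (by positivity), pow_mul, pow_mul]
    exact ENNReal.ofReal_le_ofReal (add_pow_le (sq_nonneg _) (sq_nonneg _) n)
  calc _ ≤ ∫⁻ ω, ENNReal.ofReal (2 ^ (n - 1)) *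
        (ENNReal.ofReal (A ω ^ (2 * n)) + ENNReal.ofReal (B ω ^ (2 * n))) ∂μ :=
        lintegral_mono hpt
    _ = ENNReal.ofReal (2 ^ (n - 1)) * (∫⁻ ω, ENNReal.ofReal (A ω ^ (2 * n)) ∂μ
        + ∫⁻ ω, ENNReal.ofReal (B ω ^ (2 * n)) ∂μ) := by
        rw [lintegral_const_mul _ (by fun_prop), lintegral_add_left (by fun_prop)]
    _ ≤ ENNReal.ofReal (2 ^ (n - 1)) * (ENNReal.ofReal (K₀ * σ ^ n)
        + ENNReal.ofReal (K₀ * σ ^ n)) := by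
        gcongr
        · refine (lintegral_rademacher_sum_pow_le hε hind n s _).trans
            (ENNReal.ofReal_le_ofReal ?_)
          gcongr
        · refine (lintegral_rademacher_sum_pow_le hε hind n s _).trans
            (ENNReal.ofReal_le_ofReal ?_)
          gcongr
    _ = _ := by
        rw [← hσ', ← ENNReal.ofReal_pow hσ0, ← ENNReal.ofReal_add (by positivity) (by positivity),
          ← ENNReal.ofReal_mul (by positivity), ← ENNReal.ofReal_mul (by positivity)]
        congr 1
        ring

end Khinchine

/-! ### Space-time bounds for randomized functions -/

lemma eLpNorm_natCast_pow {α ε' : Type*} [MeasurableSpace α] [ENorm ε'] {ρ : Measure α}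
    (f : α → ε') {N : ℕ} (hN : N ≠ 0) :
    eLpNorm f (N : ℝ≥0∞) ρ ^ N = ∫⁻ x, ‖f x‖ₑ ^ N ∂ρ := by
  have := eLpNorm_nnreal_pow_eq_lintegral (f := f) (μ := ρ) (p := (N : ℝ≥0))
    (by exact_mod_cast hN)
  simpa using this

lemma LowerSemicontinuous.aemeasurable_comp {α E : Type*} [MeasurableSpace α] {ρ : Measure α}
    [TopologicalSpace E] [TopologicalSpace.PseudoMetrizableSpace E] {F : E → ℝ≥0∞}
    (hF : LowerSemicontinuous F) {X : α → E} (hX : AEStronglyMeasurable X ρ) :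
    AEMeasurable (fun a => F (X a)) ρ := by
  borelize E
  exact hF.measurable.comp_aemeasurable hX.aemeasurable

section Random

variable {Ω : Type*} [MeasurableSpace Ω] {μ : Measure Ω} {ψ : Plane → ℝ}
  {ε : (Fin 2 → ℤ) → Ω → ℝ} {f : L2} {G : Ω → L2} {m : Plane → ℂ} {C : ℝ}

lemma stronglyMeasurable_partialSum (hε : ∀ k, Measurable (ε k)) (f : L2)
    (s : Finset (Fin 2 → ℤ)) : StronglyMeasurable (partialSum ψ ε f s) := by
  refine Finset.stronglyMeasurable_fun_sum s fun k _ => ?_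
  exact StronglyMeasurable.smul_const
    (Complex.measurable_ofReal.comp (hε k)).stronglyMeasurable _

lemma fourierMul_partialSum {Ω : Type*} {ε : (Fin 2 → ℤ) → Ω → ℝ} (hm : IsBddSymbol m C)
    (f : L2) (s : Finset (Fin 2 → ℤ)) (ω : Ω) :
    fourierMul m (partialSum ψ ε f s ω)
      = ∑ k ∈ s, ((ε k ω : ℝ) : ℂ) • fourierMul m (unitProj ψ k f) := by
  rw [← mulCLM_apply hm, partialSum, map_sum]
  simp only [map_smul, mulCLM_apply]

/-- The moment bound for finite sums. By Khinchine's inequality the left-hand side is controlled by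
the integral of `(∑ |a_k|²) ^ n`, where `a_k` is the `k`-th summand. Bernstein's inequality bounds
`∑ |a_k|²` uniformly in `x` by `‖f‖²`, so that only one power has to be integrated. -/
lemma exists_lintegral_eLpNorm_partialSum_le [IsProbabilityMeasure μ] (hψ : IsUnitCutoff ψ)
    (hε : ∀ k, IsRademacher (ε k) μ) (hind : iIndepFun ε μ) (f : L2) (n : ℕ) :
    ∃ K : ℝ≥0∞, K ≠ ∞ ∧ ∀ m : Plane → ℂ, IsBddSymbol m 1 → ∀ s : Finset (Fin 2 → ℤ),
      ∫⁻ ω, eLpNorm (fourierMul m (partialSum ψ ε f s ω)) (2 * (n + 1) : ℕ) volume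
        ^ (2 * (n + 1)) ∂μ ≤ K := by
  obtain ⟨K₁, hK₁, hB⟩ := hψ.exists_bernstein
  obtain ⟨K₂, hK₂, hKh⟩ := exists_khinchine hε hind (n + 1)
  refine ⟨K₂ * ((K₁ ^ 2 * ‖f‖ₑ ^ 2) ^ n * ‖f‖ₑ ^ 2), by finiteness, fun m hm s => ?_⟩
  set A : (Fin 2 → ℤ) → L2 := fun k => fourierMul m (unitProj ψ k f) with hA
  have hAm : ∀ k, Measurable (A k : Plane → ℂ) := fun k => (Lp.stronglyMeasurable (A k)).measurable
  have h1 : ∀ ω, eLpNorm (fourierMul m (partialSum ψ ε f s ω)) (2 * (n + 1) : ℕ) volume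
      ^ (2 * (n + 1)) = ∫⁻ x, ‖∑ k ∈ s, ((ε k ω : ℝ) : ℂ) * A k x‖ₑ ^ (2 * (n + 1)) := fun ω => by
    rw [eLpNorm_natCast_pow _ (by omega), fourierMul_partialSum hm]
    apply lintegral_congr_ae
    have h2 : ∀ᵐ x, ∀ k ∈ s, (((ε k ω : ℝ) : ℂ) • A k : L2) x = ((ε k ω : ℝ) : ℂ) * A k x := by
      rw [Finset.eventually_all]
      intro k _
      filter_upwards [Lp.coeFn_smul ((ε k ω : ℝ) : ℂ) (A k)] with x hx
      rw [hx, Pi.smul_apply, smul_eq_mul]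
    filter_upwards [h2, Lp.coeFn_fun_finsetSum s fun k => ((ε k ω : ℝ) : ℂ) • A k] with x hx hx'
    rw [hx', Finset.sum_congr rfl hx]
  have hmeas : Measurable (Function.uncurry fun (ω : Ω) (x : Plane) =>
      ‖∑ k ∈ s, ((ε k ω : ℝ) : ℂ) * A k x‖ₑ ^ (2 * (n + 1))) := by
    refine Measurable.pow_const (Measurable.enorm (Finset.measurable_fun_sum s fun k _ => ?_)) _
    exact (Complex.measurable_ofReal.comp ((hε k).measurable.comp measurable_fst)).mul
      ((hAm k).comp measurable_snd)
  have hA2 : ∀ k, ‖A k‖ₑ ^ 2 ≤ ‖unitProj ψ k f‖ₑ ^ 2 := fun k => by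
    gcongr
    rw [← ofReal_norm, ← ofReal_norm]
    refine ENNReal.ofReal_le_ofReal ?_
    simpa using norm_fourierMul_le hm (unitProj ψ k f)
  have hbd : ∀ᵐ x, ∑ k ∈ s, ‖A k x‖ₑ ^ 2 ≤ K₁ ^ 2 * ‖f‖ₑ ^ 2 := by
    have h3 : ∀ᵐ x, ∀ k ∈ s, ‖A k x‖ₑ ≤ K₁ * ‖unitProj ψ k f‖ₑ := by
      rw [Finset.eventually_all]
      intro k _
      filter_upwards [enorm_ae_le_eLpNormEssSup (A k : Plane → ℂ) volume] with x hx
      exact hx.trans (by simpa [eLpNorm_exponent_top] using hB k m hm f)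
    filter_upwards [h3] with x hx
    calc ∑ k ∈ s, ‖A k x‖ₑ ^ 2 ≤ ∑ k ∈ s, (K₁ * ‖unitProj ψ k f‖ₑ) ^ 2 :=
          Finset.sum_le_sum fun k hk => by gcongr; exact hx k hk
      _ = K₁ ^ 2 * ∑ k ∈ s, ‖unitProj ψ k f‖ₑ ^ 2 := by
          simp only [mul_pow, Finset.mul_sum]
      _ ≤ _ := by gcongr; exact hψ.sum_enorm_unitProj_sq_le f s
  simp only [h1]
  rw [lintegral_lintegral_swap hmeas.aemeasurable]
  calc ∫⁻ x, ∫⁻ ω, ‖∑ k ∈ s, ((ε k ω : ℝ) : ℂ) * A k x‖ₑ ^ (2 * (n + 1)) ∂μ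
      ≤ ∫⁻ x, K₂ * ((K₁ ^ 2 * ‖f‖ₑ ^ 2) ^ n * ∑ k ∈ s, ‖A k x‖ₑ ^ 2) := by
        apply lintegral_mono_ae
        filter_upwards [hbd] with x hx
        refine (hKh s fun k => A k x).trans ?_
        rw [pow_succ]
        gcongr
    _ = K₂ * ((K₁ ^ 2 * ‖f‖ₑ ^ 2) ^ n * ∑ k ∈ s, ‖A k‖ₑ ^ 2) := by
        have h4 : ∀ k ∈ s, Measurable fun x => ‖A k x‖ₑ ^ 2 := fun k _ =>
          (hAm k).enorm.pow_const 2
        rw [lintegral_const_mul _ ((Finset.measurable_fun_sum s h4).const_mul _),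
          lintegral_const_mul _ (Finset.measurable_fun_sum s h4), lintegral_finsetSum s h4]
        simp only [enorm_sq_eq_lintegral]
    _ ≤ _ := by
        gcongr
        exact (Finset.sum_le_sum fun k _ => hA2 k).trans (hψ.sum_enorm_unitProj_sq_le f s)

/-- `G` is a version of the random series `∑_k ε_k P_k f`, as a limit in `L²(Ω; L²)`. -/
structure IsRandomSeries (μ : Measure Ω) (ψ : Plane → ℝ) (ε : (Fin 2 → ℤ) → Ω → ℝ) (f : L2)
    (G : Ω → L2) : Prop where
  aestronglyMeasurable : AEStronglyMeasurable G μ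
  tendsto : Tendsto (fun s : Finset (Fin 2 → ℤ) =>
    eLpNorm (fun ω => partialSum ψ ε f s ω - G ω) 2 μ) atTop (𝓝 0)

lemma IsRandomSeries.tendstoInMeasure (hG : IsRandomSeries μ ψ ε f G)
    (hε : ∀ k, Measurable (ε k)) : TendstoInMeasure μ (fun s => partialSum ψ ε f s) atTop G :=
  tendstoInMeasure_of_tendsto_eLpNorm two_ne_zero
    (fun s => (stronglyMeasurable_partialSum hε f s).aestronglyMeasurable)
    hG.aestronglyMeasurable hG.tendsto

/-- The moment bound passes to the series by lower semicontinuity and Fatou's lemma. -/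
lemma IsRandomSeries.lintegral_eLpNorm_le (hG : IsRandomSeries μ ψ ε f G)
    (hε : ∀ k, Measurable (ε k)) (hm : IsBddSymbol m C) {p : ℝ≥0∞} {N : ℕ} {K : ℝ≥0∞}
    (hK : ∀ s : Finset (Fin 2 → ℤ),
      ∫⁻ ω, eLpNorm (fourierMul m (partialSum ψ ε f s ω)) p volume ^ N ∂μ ≤ K) :
    ∫⁻ ω, eLpNorm (fourierMul m (G ω)) p volume ^ N ∂μ ≤ K := by
  have hlsc : LowerSemicontinuous fun h : L2 =>
      eLpNorm (fourierMul m h) p (volume : Measure Plane) ^ N :=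
    (ENNReal.continuous_pow N).comp_lowerSemicontinuous
      ((lowerSemicontinuous_eLpNorm p).comp (mulCLM hm).continuous)
      (pow_left_mono N)
  obtain ⟨ns, -, hns⟩ := (hG.tendstoInMeasure hε).exists_seq_tendsto_ae'
  calc ∫⁻ ω, eLpNorm (fourierMul m (G ω)) p volume ^ N ∂μ
      ≤ ∫⁻ ω, liminf (fun i =>
          eLpNorm (fourierMul m (partialSum ψ ε f (ns i) ω)) p volume ^ N) atTop ∂μ := by
        apply lintegral_mono_ae
        filter_upwards [hns] with ω hω
        exact (hlsc.lowerSemicontinuousAt (G ω)).le_liminf.trans (liminf_le_liminf_of_le hω)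
    _ ≤ liminf (fun i => ∫⁻ ω,
          eLpNorm (fourierMul m (partialSum ψ ε f (ns i) ω)) p volume ^ N ∂μ) atTop :=
        lintegral_liminf_le' fun i => LowerSemicontinuous.aemeasurable_comp hlsc
          (stronglyMeasurable_partialSum hε f _).aestronglyMeasurable
    _ ≤ K := liminf_le_of_frequently_le' (Frequently.of_forall fun i => hK _)

/-- The symbols of a family of multipliers of norm at most one: bounded by one, and continuous in
`t` at every frequency, so that the multipliers are strongly continuous in `t`. -/
structure IsSymbolFamily (m : ℝ → Plane → ℂ) : Prop where
  symbol : ∀ t, IsBddSymbol (m t) 1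
  continuous : ∀ ξ, Continuous fun t => m t ξ

lemma IsSymbolFamily.continuous_fourierMul {m : ℝ → Plane → ℂ} (hm : IsSymbolFamily m) (h : L2) :
    Continuous fun t => fourierMul (m t) h :=
  continuous_iff_continuousAt.2 fun t => tendsto_fourierMul hm.symbol (hm.symbol t)
    (Eventually.of_forall fun ξ => (hm.continuous ξ).tendsto t) h

lemma IsSymbolFamily.continuous_uncurry {m : ℝ → Plane → ℂ} (hm : IsSymbolFamily m) :
    Continuous fun x : L2 × ℝ => fourierMul (m x.2) x.1 := by
  refine continuous_prod_of_continuous_lipschitzWith _ 1 (fun h => hm.continuous_fourierMul h)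
    fun t => LipschitzWith.of_dist_le_mul fun h h' => ?_
  have h1 := norm_fourierMul_le (hm.symbol t) (h - h')
  have h2 : fourierMul (m t) (h - h') = fourierMul (m t) h - fourierMul (m t) h' :=
    (mulCLM (hm.symbol t)).map_sub h h'
  rw [h2] at h1
  simpa [dist_eq_norm] using h1

lemma MemMixedLp.of_eq_add {q r : ℝ≥0∞} {I : Set ℝ} (hr : 1 ≤ r) {u v w : ℝ → L2}
    (hu : MemMixedLp q r I u) (hv : MemMixedLp q r I v) (hw : Continuous w)
    (h : ∀ t, w t = u t + v t) : MemMixedLp q r I w := by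
  have h1 := MemLp.add hu hv
  refine ⟨?_, (eLpNorm_mono_enorm fun t => ?_).trans_lt h1.2⟩
  · exact (LowerSemicontinuous.aemeasurable_comp (lowerSemicontinuous_eLpNorm r)
      hw.aestronglyMeasurable).aestronglyMeasurable
  · simp only [Pi.add_apply, enorm_eq_self]
    rw [h, eLpNorm_congr_ae (Lp.coeFn_add _ _)]
    exact eLpNorm_add_le (Lp.aestronglyMeasurable _) (Lp.aestronglyMeasurable _) hr

/-- A curve `t ↦ fourierMul (m t) h` is bounded in `L²`, so that by interpolation an
`L^N_t L^N_x` bound controls all lower exponents. -/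
lemma IsSymbolFamily.memMixedLp_of_lintegral_lt_top {m : ℝ → Plane → ℂ} (hm : IsSymbolFamily m)
    {q r : ℝ≥0∞} (hr : 2 ≤ r) (hr_top : r < ∞) {N : ℕ} (hN : N ≠ 0) (hqN : q ≤ N)
    (hrN : r.toReal ≤ N) {I : Set ℝ} [IsFiniteMeasure (volume.restrict I)] {h : L2}
    (hfin : ∫⁻ t in I, eLpNorm (fourierMul (m t) h) N (volume : Measure Plane) ^ N < ∞) :
    MemMixedLp q r I fun t => fourierMul (m t) h := by
  have hae : ∀ p : ℝ≥0∞, AEStronglyMeasurable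
      (fun t => eLpNorm (fourierMul (m t) h) p volume) (volume.restrict I) := fun p =>
    (LowerSemicontinuous.aemeasurable_comp (lowerSemicontinuous_eLpNorm p)
      (hm.continuous_fourierMul h).aestronglyMeasurable).aestronglyMeasurable
  have h1 : MemLp (fun t => eLpNorm (fourierMul (m t) h) N volume) N (volume.restrict I) := by
    refine ⟨hae _, ?_⟩
    rw [eLpNorm_lt_top_iff_lintegral_rpow_enorm_lt_top (by exact_mod_cast hN)
      (ENNReal.natCast_ne_top N)]
    simpa using hfin
  have h2 : MemLp (fun _ : ℝ => ‖h‖ₑ) N (volume.restrict I) := memLp_const_enorm (by simp)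
  have h3 := (h2.add h1).mono_exponent hqN
  refine ⟨hae _, (eLpNorm_mono_enorm fun t => ?_).trans_lt (h3.add h3).2⟩
  simp only [Pi.add_apply, enorm_eq_self]
  have h4 := eLpNorm_le_two_mul_add (Lp.aestronglyMeasurable (fourierMul (m t) h))
    (r := r.toReal) (p := N) (by simpa using ENNReal.toReal_mono hr_top.ne hr) hrN
  rw [ENNReal.ofReal_toReal hr_top.ne, ENNReal.ofReal_natCast, ← Lp.enorm_def] at h4
  rw [← two_mul]
  refine h4.trans ?_
  gcongr
  rw [← ofReal_norm, ← ofReal_norm]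
  refine ENNReal.ofReal_le_ofReal ?_
  simpa using norm_fourierMul_le (hm.symbol t) h

/-- Tonelli's theorem turns moment bounds at fixed times into an almost sure space-time bound. -/
lemma ae_lintegral_eLpNorm_lt_top [SFinite μ] {T : ℝ → L2 → L2}
    (hT : Continuous fun y : L2 × ℝ => T y.2 y.1) (hG : AEStronglyMeasurable G μ) {N : ℕ}
    {K : ℝ≥0∞} (hK : K ≠ ∞) (hGK : ∀ t, ∫⁻ ω, eLpNorm (T t (G ω)) N volume ^ N ∂μ ≤ K)
    (I : Set ℝ) [IsFiniteMeasure (volume.restrict I)] :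
    ∀ᵐ ω ∂μ, ∫⁻ t in I, eLpNorm (T t (G ω)) N (volume : Measure Plane) ^ N < ∞ := by
  have hlsc : LowerSemicontinuous fun h : L2 => eLpNorm h N (volume : Measure Plane) ^ N :=
    (ENNReal.continuous_pow N).comp_lowerSemicontinuous (lowerSemicontinuous_eLpNorm N)
      (pow_left_mono N)
  have hsnd : AEStronglyMeasurable (fun x : Ω × ℝ => x.2) (μ.prod (volume.restrict I)) :=
    measurable_snd.aestronglyMeasurable
  have hmeas : AEMeasurable (Function.uncurry fun (ω : Ω) (t : ℝ) =>
      eLpNorm (T t (G ω)) N (volume : Measure Plane) ^ N) (μ.prod (volume.restrict I)) := by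
    have hpair := hG.comp_fst.prodMk hsnd
    have hcomp := LowerSemicontinuous.aemeasurable_comp (hlsc.comp hT) hpair
    exact hcomp
  refine ae_lt_top' hmeas.lintegral_prod_right' ?_
  rw [lintegral_lintegral_swap hmeas]
  refine ((lintegral_mono hGK).trans_lt ?_).ne
  rw [lintegral_const]
  exact ENNReal.mul_lt_top hK.lt_top (measure_lt_top _ _)

/-- Almost surely, a strongly continuous family of contractive multipliers applied to a randomized
`L²` function is in `L^q_t L^r_x` on bounded intervals: this is controlled by the `L^N_t L^N_x`
norm for an even integer `N ≥ q, r`, whose `N`-th power has finite expectation. -/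
lemma IsRandomSeries.ae_memMixedLp [IsProbabilityMeasure μ] (hψ : IsUnitCutoff ψ)
    (hε : ∀ k, IsRademacher (ε k) μ) (hind : iIndepFun ε μ) (hG : IsRandomSeries μ ψ ε f G)
    {m : ℝ → Plane → ℂ} (hm : IsSymbolFamily m) {q r : ℝ≥0∞} (hq_top : q < ∞) (hr : 2 ≤ r)
    (hr_top : r < ∞) {I : Set ℝ} (hI : Bornology.IsBounded I) :
    ∀ᵐ ω ∂μ, MemMixedLp q r I fun t => fourierMul (m t) (G ω) := by
  have hfin : IsFiniteMeasure (volume.restrict I) := isFiniteMeasure_restrict.2 hI.measure_lt_top.ne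
  obtain ⟨n, hn⟩ := exists_nat_ge (max q.toReal r.toReal)
  obtain ⟨K, hK, hKs⟩ := exists_lintegral_eLpNorm_partialSum_le hψ hε hind f n
  obtain ⟨N, hN⟩ : ∃ N, N = 2 * (n + 1) := ⟨_, rfl⟩
  rw [← hN] at hKs
  have hnN : (n : ℝ) ≤ N := by rw [hN]; push_cast; linarith
  have hqN : q ≤ N := by
    rw [← ENNReal.ofReal_toReal hq_top.ne, ← ENNReal.ofReal_natCast]
    exact ENNReal.ofReal_le_ofReal (((le_max_left _ _).trans hn).trans hnN)
  have hrN : r.toReal ≤ N := ((le_max_right _ _).trans hn).trans hnN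
  filter_upwards [ae_lintegral_eLpNorm_lt_top (T := fun t h => fourierMul (m t) h)
    hm.continuous_uncurry hG.aestronglyMeasurable hK (fun t =>
      hG.lintegral_eLpNorm_le (fun k => (hε k).measurable) (hm.symbol t)
        (hKs (m t) (hm.symbol t))) I] with ω hω
  exact hm.memMixedLp_of_lintegral_lt_top hr hr_top (by omega) hqN hrN hω

end Random

/-! ### Existence and uniqueness of the randomization -/

section Random

variable {Ω : Type*} [MeasurableSpace Ω] {μ : Measure Ω} {ψ : Plane → ℝ}
  {ε ν : (Fin 2 → ℤ) → Ω → ℝ} {f : L2} {G G' : Ω → L2} {m : Plane → ℂ} {C : ℝ}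

lemma eLpNorm_two_sq {E : Type*} [NormedAddCommGroup E] (X : Ω → E) :
    eLpNorm X 2 μ ^ 2 = ∫⁻ ω, ‖X ω‖ₑ ^ 2 ∂μ := by
  simpa using eLpNorm_natCast_pow (ρ := μ) X two_ne_zero

lemma IsRademacher.memLp_smul [IsProbabilityMeasure μ] {X : Ω → ℝ} (hX : IsRademacher X μ)
    (h : L2) : MemLp (fun ω => ((X ω : ℝ) : ℂ) • h) 2 μ := by
  refine MemLp.of_bound (C := ‖h‖) (StronglyMeasurable.smul_const
    (Complex.measurable_ofReal.comp hX.measurable).stronglyMeasurable h).aestronglyMeasurable ?_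
  filter_upwards [hX.ae_eq_or] with ω hω
  rcases hω with h1 | h1 <;> simp [h1]

/-- Multiplication by a Rademacher variable, as an isometric embedding of `L²` into `L²(Ω; L²)`. -/
def rademacherEmb [IsProbabilityMeasure μ] {X : Ω → ℝ} (hX : IsRademacher X μ) :
    L2 →ₗᵢ[ℂ] Lp L2 2 μ where
  toFun h := (hX.memLp_smul h).toLp _
  map_add' h h' := by
    rw [← MemLp.toLp_add]
    exact MemLp.toLp_congr _ _ (Eventually.of_forall fun ω => smul_add _ _ _)
  map_smul' c h := by
    rw [RingHom.id_apply, ← MemLp.toLp_const_smul]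
    exact MemLp.toLp_congr _ _ (Eventually.of_forall fun ω => smul_comm _ _ _)
  norm_map' h := by
    change ‖(hX.memLp_smul h).toLp _‖ = ‖h‖
    rw [Lp.norm_toLp]
    have h1 : eLpNorm (fun ω => ((X ω : ℝ) : ℂ) • h) 2 μ = eLpNorm (fun _ : Ω => h) 2 μ := by
      apply eLpNorm_congr_norm_ae
      filter_upwards [hX.ae_eq_or] with ω hω
      rcases hω with h1 | h1 <;> simp [h1]
    rw [h1, eLpNorm_const _ two_ne_zero (IsProbabilityMeasure.ne_zero μ)]
    simp

lemma orthogonalFamily_rademacherEmb [IsProbabilityMeasure μ] {ι : Type*} {ε : ι → Ω → ℝ}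
    (hε : ∀ k, IsRademacher (ε k) μ) (hind : iIndepFun ε μ) :
    OrthogonalFamily ℂ (fun _ : ι => L2) fun k => rademacherEmb (hε k) := by
  intro i j hij v w
  change inner ℂ (((hε i).memLp_smul v).toLp _) (((hε j).memLp_smul w).toLp _) = 0
  rw [L2.inner_def]
  have h1 : (fun ω => inner ℂ (((hε i).memLp_smul v).toLp _ ω) (((hε j).memLp_smul w).toLp _ ω))
      =ᵐ[μ] fun ω => ((ε i ω * ε j ω : ℝ) : ℂ) * inner ℂ v w := by
    filter_upwards [((hε i).memLp_smul v).coeFn_toLp, ((hε j).memLp_smul w).coeFn_toLp]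
      with ω h1 h2
    rw [h1, h2, inner_smul_left, inner_smul_right, Complex.conj_ofReal]
    push_cast
    ring
  rw [integral_congr_ae h1, integral_mul_const, integral_complex_ofReal,
    (hind.indepFun hij).integral_fun_mul_eq_mul_integral
      (hε i).measurable.aestronglyMeasurable (hε j).measurable.aestronglyMeasurable,
    (hε i).integral_eq_zero]
  simp

/-- The terms of the random series are orthogonal in `L²(Ω; L²)`, with square-summable norms. -/
lemma exists_isRandomSeries [IsProbabilityMeasure μ] (hψ : IsUnitCutoff ψ)
    (hε : ∀ k, IsRademacher (ε k) μ) (hind : iIndepFun ε μ) (f : L2) :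
    ∃ G, IsRandomSeries μ ψ ε f G := by
  have hsq : Summable fun k => ‖unitProj ψ k f‖ ^ 2 := by
    refine summable_of_sum_le (c := ‖f‖ ^ 2) (fun k => by positivity) fun s => ?_
    have h := hψ.sum_enorm_unitProj_sq_le f s
    have h1 : ∀ x : L2, ‖x‖ₑ ^ 2 = ENNReal.ofReal (‖x‖ ^ 2) := fun x => by
      rw [ENNReal.ofReal_pow (norm_nonneg _), ofReal_norm]
    simp only [h1] at h
    rwa [← ENNReal.ofReal_sum_of_nonneg (fun k _ => by positivity),
      ENNReal.ofReal_le_ofReal_iff (by positivity)] at h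
  obtain ⟨S, hS⟩ := ((orthogonalFamily_rademacherEmb hε hind).summable_iff_norm_sq_summable
    fun k => unitProj ψ k f).2 hsq
  refine ⟨S, Lp.aestronglyMeasurable S, ?_⟩
  have h1 := (Lp.tendsto_Lp_iff_tendsto_eLpNorm' _ _).1 hS
  refine h1.congr fun s => eLpNorm_congr_ae ?_
  have h2 : ∀ᵐ ω ∂μ, ∀ k ∈ s, (rademacherEmb (hε k) (unitProj ψ k f)) ω
      = ((ε k ω : ℝ) : ℂ) • unitProj ψ k f := by
    rw [Finset.eventually_all]
    exact fun k _ => ((hε k).memLp_smul (unitProj ψ k f)).coeFn_toLp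
  filter_upwards [h2, Lp.coeFn_fun_finsetSum s fun k => rademacherEmb (hε k) (unitProj ψ k f)]
    with ω h3 h4
  rw [Pi.sub_apply, h4, Finset.sum_congr rfl h3, partialSum]

lemma IsRandomSeries.ae_eq (hG : IsRandomSeries μ ψ ε f G) (hG' : IsRandomSeries μ ψ ε f G')
    (hε : ∀ k, Measurable (ε k)) : G =ᵐ[μ] G' :=
  tendstoInMeasure_ae_unique (hG.tendstoInMeasure hε) (hG'.tendstoInMeasure hε)

lemma partialSum_fourierMul {Ω : Type*} {ε : (Fin 2 → ℤ) → Ω → ℝ} (hψ : IsUnitCutoff ψ)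
    (hm : IsBddSymbol m C) (f : L2) (s : Finset (Fin 2 → ℤ)) (ω : Ω) :
    partialSum ψ ε (fourierMul m f) s ω = fourierMul m (partialSum ψ ε f s ω) := by
  rw [fourierMul_partialSum hm, partialSum]
  refine Finset.sum_congr rfl fun k _ => ?_
  unfold unitProj
  rw [fourierMul_fourierMul (hψ.isBddSymbol k) hm, fourierMul_fourierMul hm (hψ.isBddSymbol k)]
  simp only [mul_comm]

/-- Multipliers commute with the projections `P_k`, hence with the randomization. -/
lemma IsRandomSeries.fourierMul (hψ : IsUnitCutoff ψ) (hG : IsRandomSeries μ ψ ε f G)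
    (hm : IsBddSymbol m 1) :
    IsRandomSeries μ ψ ε (fourierMul m f) fun ω => fourierMul m (G ω) := by
  refine ⟨(mulCLM hm).continuous.comp_aestronglyMeasurable hG.aestronglyMeasurable,
    tendsto_of_tendsto_of_tendsto_of_le_of_le tendsto_const_nhds hG.tendsto
      (fun _ => zero_le) fun s => eLpNorm_mono fun ω => ?_⟩
  rw [partialSum_fourierMul hψ hm, ← mulCLM_apply hm, ← mulCLM_apply hm, ← map_sub, mulCLM_apply]
  simpa using norm_fourierMul_le hm (partialSum ψ ε f s ω - G ω)

/-- The symbol `(1 + |2πξ|²)^{1/2}`. -/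
def japaneseBracket (ξ : Plane) : ℝ := Real.sqrt (1 + absNabla ξ ^ 2)

/-- The symbol of `(1 + |∇|²)^{-1/2}`, which maps `L²` isometrically onto `H¹`. -/
def besselSymbol (ξ : Plane) : ℂ := ((japaneseBracket ξ)⁻¹ : ℝ)

lemma one_le_japaneseBracket (ξ : Plane) : 1 ≤ japaneseBracket ξ := by
  rw [japaneseBracket, Real.one_le_sqrt]
  linarith [sq_nonneg (absNabla ξ)]

lemma absNabla_nonneg (ξ : Plane) : 0 ≤ absNabla ξ := by unfold absNabla; positivity

lemma absNabla_le_japaneseBracket (ξ : Plane) : absNabla ξ ≤ japaneseBracket ξ :=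
  Real.le_sqrt_of_sq_le (by linarith)

lemma continuous_absNabla : Continuous absNabla := by unfold absNabla; fun_prop

lemma continuous_japaneseBracket : Continuous japaneseBracket := by
  have := continuous_absNabla
  unfold japaneseBracket
  fun_prop

lemma isBddSymbol_besselSymbol : IsBddSymbol besselSymbol 1 := by
  refine ⟨Complex.measurable_ofReal.comp continuous_japaneseBracket.measurable.inv, fun ξ => ?_⟩
  have h := one_le_japaneseBracket ξ
  rw [besselSymbol, Complex.norm_real, Real.norm_eq_abs, abs_of_nonneg (by positivity)]
  exact inv_le_one_of_one_le₀ h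

lemma japaneseBracket_mul_besselSymbol (ξ : Plane) :
    (japaneseBracket ξ : ℂ) * besselSymbol ξ = 1 := by
  have h := one_le_japaneseBracket ξ
  rw [besselSymbol, ← Complex.ofReal_mul, mul_inv_cancel₀ (by linarith), Complex.ofReal_one]

lemma h1ENorm_fourierMul_besselSymbol (h : L2) : h1ENorm (fourierMul besselSymbol h) = ‖h‖ₑ := by
  rw [← enorm_fourier, Lp.enorm_def, h1ENorm]
  apply eLpNorm_congr_ae
  filter_upwards [fourier_fourierMul isBddSymbol_besselSymbol h] with ξ hξ
  rw [hξ, ← mul_assoc]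
  change (japaneseBracket ξ : ℂ) * besselSymbol ξ * _ = _
  rw [japaneseBracket_mul_besselSymbol, one_mul]

lemma enorm_le_h1ENorm (h : L2) : ‖h‖ₑ ≤ h1ENorm h := by
  rw [← enorm_fourier, Lp.enorm_def, h1ENorm]
  refine eLpNorm_mono fun ξ => ?_
  rw [norm_mul]
  refine le_mul_of_one_le_left (norm_nonneg _) ?_
  rw [Complex.norm_real, Real.norm_eq_abs, abs_of_nonneg (Real.sqrt_nonneg _)]
  exact one_le_japaneseBracket ξ

lemma exists_eq_fourierMul_besselSymbol {φ : L2}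
    (hφ : MemSobolev 1 2 ((φ : L2) : 𝓢'(Plane, ℂ))) :
    ∃ g : L2, φ = fourierMul besselSymbol g := by
  have h1 : MemLp (fun ξ => (japaneseBracket ξ : ℂ) * (𝓕 φ : L2) ξ) 2 volume :=
    ⟨(Complex.measurable_ofReal.comp continuous_japaneseBracket.measurable).aestronglyMeasurable.mul
      (Lp.aestronglyMeasurable _), (memSobolev_one_iff φ).1 hφ⟩
  refine ⟨𝓕⁻ (h1.toLp _ : L2), eq_of_fourier_ae_eq ?_⟩
  filter_upwards [fourier_fourierMul isBddSymbol_besselSymbol (𝓕⁻ (h1.toLp _ : L2)),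
    h1.coeFn_toLp] with ξ h2 h3
  rw [h2, FourierTransform.fourier_fourierInv_eq, h3, ← mul_assoc, mul_comm (besselSymbol ξ),
    japaneseBracket_mul_besselSymbol, one_mul]

lemma tendsto_eLpNorm_two_of_sq {ι : Type*} {l : Filter ι} {E : Type*} [NormedAddCommGroup E]
    {X : ι → Ω → E} (h : Tendsto (fun i => ∫⁻ ω, ‖X i ω‖ₑ ^ 2 ∂μ) l (𝓝 0)) :
    Tendsto (fun i => eLpNorm (X i) 2 μ) l (𝓝 0) := by
  have := h.ennrpow_const (1 / 2)
  simp only [one_div, ENNReal.zero_rpow_of_pos (show (0 : ℝ) < 2⁻¹ by norm_num)] at this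
  refine this.congr fun i => ?_
  rw [← eLpNorm_two_sq, ← ENNReal.rpow_natCast, ← ENNReal.rpow_mul]
  norm_num

variable {φ₀ φ₁ g : L2} {Φ₀ Φ₁ : Ω → L2}

lemma IsRandomization.isRandomSeries_zero (h : IsRandomization μ ψ ε ν φ₀ φ₁ Φ₀ Φ₁) :
    IsRandomSeries μ ψ ε φ₀ Φ₀ := by
  refine ⟨h.aestronglyMeasurable_zero, tendsto_eLpNorm_two_of_sq ?_⟩
  refine tendsto_of_tendsto_of_tendsto_of_le_of_le tendsto_const_nhds h.tendsto
    (fun _ => zero_le) fun s => lintegral_mono fun ω => ?_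
  refine le_add_right ?_
  gcongr
  exact enorm_le_h1ENorm _

lemma IsRandomization.isRandomSeries_one (h : IsRandomization μ ψ ε ν φ₀ φ₁ Φ₀ Φ₁) :
    IsRandomSeries μ ψ ν φ₁ Φ₁ := by
  refine ⟨h.aestronglyMeasurable_one, tendsto_eLpNorm_two_of_sq ?_⟩
  exact tendsto_of_tendsto_of_tendsto_of_le_of_le tendsto_const_nhds h.tendsto
    (fun _ => zero_le) fun s => lintegral_mono fun ω => le_add_left le_rfl

/-- Randomization commutes with `(1 + |∇|²)^{-1/2}`, which reduces the `H¹` component to `L²`. -/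
lemma isRandomization_of_isRandomSeries (hψ : IsUnitCutoff ψ) (hε : ∀ k, Measurable (ε k))
    (hG : IsRandomSeries μ ψ ε g G) (hG' : IsRandomSeries μ ψ ν φ₁ G') :
    IsRandomization μ ψ ε ν (fourierMul besselSymbol g) φ₁
      (fun ω => fourierMul besselSymbol (G ω)) G' := by
  refine ⟨(hG.fourierMul hψ isBddSymbol_besselSymbol).aestronglyMeasurable,
    hG'.aestronglyMeasurable, ?_⟩
  have h1 : ∀ s : Finset (Fin 2 → ℤ), ∫⁻ ω,
      (h1ENorm (partialSum ψ ε (fourierMul besselSymbol g) s ω - fourierMul besselSymbol (G ω)) ^ 2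
        + ‖partialSum ψ ν φ₁ s ω - G' ω‖ₑ ^ 2) ∂μ
      = eLpNorm (fun ω => partialSum ψ ε g s ω - G ω) 2 μ ^ 2
        + eLpNorm (fun ω => partialSum ψ ν φ₁ s ω - G' ω) 2 μ ^ 2 := fun s => by
    have h2 : ∀ ω, h1ENorm (partialSum ψ ε (fourierMul besselSymbol g) s ω
        - fourierMul besselSymbol (G ω)) = ‖partialSum ψ ε g s ω - G ω‖ₑ := fun ω => by
      rw [partialSum_fourierMul hψ isBddSymbol_besselSymbol,
        ← mulCLM_apply isBddSymbol_besselSymbol, ← mulCLM_apply isBddSymbol_besselSymbol,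
        ← map_sub, mulCLM_apply, h1ENorm_fourierMul_besselSymbol]
    simp only [h2]
    rw [lintegral_add_left', eLpNorm_two_sq, eLpNorm_two_sq]
    exact (((stronglyMeasurable_partialSum hε g s).aestronglyMeasurable.sub
      hG.aestronglyMeasurable).enorm).pow_const 2
  simp only [h1]
  have h3 := (ENNReal.Tendsto.pow (n := 2) hG.tendsto).add
    (ENNReal.Tendsto.pow (n := 2) hG'.tendsto)
  simpa using h3

end Random

/-! ### The gradient of the free wave -/

section Gradient

variable {m : Plane → ℂ} {C C' : ℝ}

/-- Differentiation of a multiplier under a bound on the derivative of its symbol. -/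
lemma hasDerivAt_fourierMul {M M' : ℝ → Plane → ℂ} {R : ℝ → ℝ}
    (hM : ∀ t, IsBddSymbol (M t) (R t)) (hM' : ∀ t, IsBddSymbol (M' t) 1)
    (hd : ∀ ξ t, HasDerivAt (fun t => M t ξ) (M' t ξ) t) (h : L2) (t : ℝ) :
    HasDerivAt (fun t => fourierMul (M t) h) (fourierMul (M' t) h) t := by
  rw [hasDerivAt_iff_tendsto_slope]
  have hslope : ∀ s, IsBddSymbol (fun ξ => (((s - t)⁻¹ : ℝ) : ℂ) * (M s ξ - M t ξ)) 1 := fun s => by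
    refine ⟨(((hM s).measurable.sub (hM t).measurable).const_mul _), fun ξ => ?_⟩
    have h1 : ‖M s ξ - M t ξ‖ ≤ 1 * ‖s - t‖ :=
      convex_univ.norm_image_sub_le_of_norm_hasDerivWithin_le
        (fun x _ => (hd ξ x).hasDerivWithinAt) (fun x _ => (hM' x).bound ξ)
        (Set.mem_univ t) (Set.mem_univ s)
    rw [norm_mul, Complex.norm_real, norm_inv]
    calc ‖s - t‖⁻¹ * ‖M s ξ - M t ξ‖ ≤ ‖s - t‖⁻¹ * (1 * ‖s - t‖) := by gcongr
      _ ≤ 1 := by rw [one_mul]; exact inv_mul_le_one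
  have h2 : slope (fun t => fourierMul (M t) h) t
      = fun s => fourierMul (fun ξ => (((s - t)⁻¹ : ℝ) : ℂ) * (M s ξ - M t ξ)) h := by
    funext s
    rw [slope_def_module, fourierMul_const_mul_left ((hM s).sub (hM t)),
      fourierMul_sub_left (hM s) (hM t)]
    rfl
  rw [h2]
  refine tendsto_fourierMul hslope (hM' t) (Eventually.of_forall fun ξ => ?_) h
  have h3 := hasDerivAt_iff_tendsto_slope.1 (hd ξ t)
  refine h3.congr fun s => ?_
  rw [slope_def_module, Complex.real_smul]

/-- The symbol `2πiξ_j` of the partial derivative `∂_j`. -/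
def derivSymbol (j : Fin 2) (ξ : Plane) : ℂ := 2 * Real.pi * Complex.I * (ξ j : ℝ)

lemma norm_derivSymbol_le (j : Fin 2) (ξ : Plane) : ‖derivSymbol j ξ‖ ≤ absNabla ξ := by
  have h1 : |ξ j| ≤ ‖ξ‖ := by simpa using PiLp.norm_apply_le ξ j
  simp only [derivSymbol, norm_mul, Complex.norm_real, Complex.norm_I, Complex.norm_ofNat,
    Real.norm_eq_abs, abs_of_pos Real.pi_pos, absNabla, mul_one]
  gcongr

lemma measurable_derivSymbol (j : Fin 2) : Measurable (derivSymbol j) := by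
  unfold derivSymbol
  fun_prop

/-- The distributional derivative of a multiplier, read off on the Fourier side. -/
lemma lineDeriv_fourierMul (hm : IsBddSymbol m C) (j : Fin 2)
    (hm' : IsBddSymbol (fun ξ => derivSymbol j ξ * m ξ) C') (h : L2) :
    ∂_{(EuclideanSpace.single j (1 : ℝ) : Plane)} ((fourierMul m h : L2) : 𝓢'(Plane, ℂ))
      = ((fourierMul (fun ξ => derivSymbol j ξ * m ξ) h : L2) : 𝓢'(Plane, ℂ)) := by
  have hinj : Function.Injective (𝓕 : 𝓢'(Plane, ℂ) → 𝓢'(Plane, ℂ)) := fun T S hTS => by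
    have := congrArg (fun X : 𝓢'(Plane, ℂ) => (𝓕⁻ X : 𝓢'(Plane, ℂ))) hTS
    simpa using this
  apply hinj
  rw [TemperedDistribution.fourier_lineDerivOp_eq, Lp.fourier_toTemperedDistribution_eq,
    Lp.fourier_toTemperedDistribution_eq]
  have hg : (fun x : Plane =>
      ((inner ℝ x (EuclideanSpace.single j (1 : ℝ) : Plane) : ℝ) : ℂ)).HasTemperateGrowth := by
    fun_prop
  ext u
  change (2 * Real.pi * Complex.I : ℂ) • (smulLeftCLM ℂ _ _) u = _
  rw [smulLeftCLM_apply_apply, Lp.toTemperedDistribution_apply, Lp.toTemperedDistribution_apply,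
    ← integral_smul]
  apply integral_congr_ae
  filter_upwards [fourier_fourierMul hm h, fourier_fourierMul hm' h] with ξ h1 h2
  rw [h1, h2, SchwartzMap.smulLeftCLM_apply_apply hg, EuclideanSpace.inner_single_right]
  simp only [smul_eq_mul, derivSymbol]
  simp
  ring

/-- The symbol `cos (t|∇|) (1 + |∇|²)^{-1/2}` of the cosine propagator on `H¹`. -/
def cosSymbol (t : ℝ) (ξ : Plane) : ℂ :=
  ((Real.cos (t * absNabla ξ) / japaneseBracket ξ : ℝ) : ℂ)

/-- The time derivative of `cosSymbol`. -/
def cosSymbolDeriv (t : ℝ) (ξ : Plane) : ℂ :=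
  ((-Real.sin (t * absNabla ξ) * absNabla ξ / japaneseBracket ξ : ℝ) : ℂ)

/-- The symbol `sin (t|∇|) / |∇|` of the sine propagator, with value `0` at `ξ = 0`. -/
def sinSymbol (t : ℝ) (ξ : Plane) : ℂ := ((Real.sin (t * absNabla ξ) / absNabla ξ : ℝ) : ℂ)

/-- The time derivative `cos (t|∇|)` of `sinSymbol`; as for `sinSymbol`, the value at `ξ = 0` is
`0`. -/
def sinSymbolDeriv (t : ℝ) (ξ : Plane) : ℂ :=
  ((Real.cos (t * absNabla ξ) * absNabla ξ / absNabla ξ : ℝ) : ℂ)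

lemma hasDerivAt_cosSymbol (ξ : Plane) (t : ℝ) :
    HasDerivAt (fun t => cosSymbol t ξ) (cosSymbolDeriv t ξ) t := by
  have h := ((Real.hasDerivAt_cos (t * absNabla ξ)).comp t
    ((hasDerivAt_id t).mul_const (absNabla ξ))).div_const (japaneseBracket ξ)
  rw [one_mul] at h
  exact h.ofReal_comp

lemma hasDerivAt_sinSymbol (ξ : Plane) (t : ℝ) :
    HasDerivAt (fun t => sinSymbol t ξ) (sinSymbolDeriv t ξ) t := by
  have h := ((Real.hasDerivAt_sin (t * absNabla ξ)).comp t
    ((hasDerivAt_id t).mul_const (absNabla ξ))).div_const (absNabla ξ)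
  rw [one_mul] at h
  exact h.ofReal_comp

lemma measurable_cosSymbol (t : ℝ) : Measurable (cosSymbol t) := by
  have h1 := continuous_absNabla.measurable
  have h2 := continuous_japaneseBracket.measurable
  unfold cosSymbol
  fun_prop

lemma measurable_sinSymbol (t : ℝ) : Measurable (sinSymbol t) := by
  have h1 := continuous_absNabla.measurable
  unfold sinSymbol
  fun_prop

lemma isBddSymbol_cosSymbol (t : ℝ) : IsBddSymbol (cosSymbol t) 1 := by
  refine ⟨measurable_cosSymbol t, fun ξ => ?_⟩
  have h := one_le_japaneseBracket ξ
  rw [cosSymbol, Complex.norm_real, Real.norm_eq_abs, abs_div,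
    abs_of_pos (show 0 < japaneseBracket ξ by linarith)]
  exact div_le_one_of_le₀ ((Real.abs_cos_le_one _).trans h) (by linarith)

lemma isBddSymbol_sinSymbol (t : ℝ) : IsBddSymbol (sinSymbol t) |t| := by
  refine ⟨measurable_sinSymbol t, fun ξ => ?_⟩
  have h := absNabla_nonneg ξ
  rw [sinSymbol, Complex.norm_real, Real.norm_eq_abs, abs_div, abs_of_nonneg h]
  refine div_le_of_le_mul₀ h (abs_nonneg t) ?_
  refine Real.abs_sin_le_abs.trans ?_
  rw [abs_mul, abs_of_nonneg h]

lemma isSymbolFamily_cosSymbolDeriv : IsSymbolFamily cosSymbolDeriv := by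
  refine ⟨fun t => ⟨?_, fun ξ => ?_⟩, fun ξ => ?_⟩
  · have h1 := continuous_absNabla.measurable
    have h2 := continuous_japaneseBracket.measurable
    unfold cosSymbolDeriv
    fun_prop
  · have h := one_le_japaneseBracket ξ
    rw [cosSymbolDeriv, Complex.norm_real, Real.norm_eq_abs, abs_div, abs_mul, abs_neg,
      abs_of_pos (show 0 < japaneseBracket ξ by linarith), abs_of_nonneg (absNabla_nonneg ξ)]
    refine div_le_one_of_le₀ ?_ (by linarith)
    exact (mul_le_of_le_one_left (absNabla_nonneg ξ) (Real.abs_sin_le_one _)).trans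
      (absNabla_le_japaneseBracket ξ)
  · unfold cosSymbolDeriv
    fun_prop

lemma isSymbolFamily_sinSymbolDeriv : IsSymbolFamily sinSymbolDeriv := by
  refine ⟨fun t => ⟨?_, fun ξ => ?_⟩, fun ξ => ?_⟩
  · have h1 := continuous_absNabla.measurable
    unfold sinSymbolDeriv
    fun_prop
  · have h := absNabla_nonneg ξ
    rw [sinSymbolDeriv, Complex.norm_real, Real.norm_eq_abs, abs_div, abs_mul, abs_of_nonneg h]
    exact div_le_one_of_le₀ (mul_le_of_le_one_left h (Real.abs_cos_le_one _)) h
  · unfold sinSymbolDeriv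
    fun_prop

lemma isSymbolFamily_derivSymbol_mul_cosSymbol (j : Fin 2) :
    IsSymbolFamily fun t ξ => derivSymbol j ξ * cosSymbol t ξ := by
  refine ⟨fun t => ⟨(measurable_derivSymbol j).mul (measurable_cosSymbol t), fun ξ => ?_⟩,
    fun ξ => ?_⟩
  · have h := one_le_japaneseBracket ξ
    rw [norm_mul, cosSymbol, Complex.norm_real, Real.norm_eq_abs, abs_div,
      abs_of_pos (show 0 < japaneseBracket ξ by linarith), ← mul_div_assoc]
    refine div_le_one_of_le₀ ?_ (by linarith)
    exact (mul_le_of_le_one_right (norm_nonneg _) (Real.abs_cos_le_one _)).trans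
      ((norm_derivSymbol_le j ξ).trans (absNabla_le_japaneseBracket ξ))
  · unfold cosSymbol
    fun_prop

lemma isSymbolFamily_derivSymbol_mul_sinSymbol (j : Fin 2) :
    IsSymbolFamily fun t ξ => derivSymbol j ξ * sinSymbol t ξ := by
  refine ⟨fun t => ⟨(measurable_derivSymbol j).mul (measurable_sinSymbol t), fun ξ => ?_⟩,
    fun ξ => ?_⟩
  · have h := absNabla_nonneg ξ
    rw [norm_mul, sinSymbol, Complex.norm_real, Real.norm_eq_abs, abs_div, abs_of_nonneg h,
      ← mul_div_assoc]
    refine div_le_one_of_le₀ ?_ h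
    exact (mul_le_of_le_one_right (norm_nonneg _) (Real.abs_sin_le_one _)).trans
      (norm_derivSymbol_le j ξ)
  · unfold sinSymbol
    fun_prop

/-- The symbols of `(∂_t, ∂₁, ∂₂) cos (t|∇|) (1 + |∇|²)^{-1/2}`. -/
def gradSymbolZero : Fin 3 → ℝ → Plane → ℂ :=
  Fin.cons cosSymbolDeriv fun j t ξ => derivSymbol j ξ * cosSymbol t ξ

/-- The symbols of `(∂_t, ∂₁, ∂₂) sin (t|∇|) / |∇|`. -/
def gradSymbolOne : Fin 3 → ℝ → Plane → ℂ :=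
  Fin.cons sinSymbolDeriv fun j t ξ => derivSymbol j ξ * sinSymbol t ξ

lemma isSymbolFamily_gradSymbolZero (α : Fin 3) : IsSymbolFamily (gradSymbolZero α) := by
  refine Fin.cases ?_ (fun j => ?_) α
  · exact isSymbolFamily_cosSymbolDeriv
  · exact isSymbolFamily_derivSymbol_mul_cosSymbol j

lemma isSymbolFamily_gradSymbolOne (α : Fin 3) : IsSymbolFamily (gradSymbolOne α) := by
  refine Fin.cases ?_ (fun j => ?_) α
  · exact isSymbolFamily_sinSymbolDeriv
  · exact isSymbolFamily_derivSymbol_mul_sinSymbol j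

lemma freeWave_fourierMul_besselSymbol (g₀ g₁ : L2) (t : ℝ) :
    freeWave (fourierMul besselSymbol g₀) g₁ t
      = fourierMul (cosSymbol t) g₀ + fourierMul (sinSymbol t) g₁ := by
  have hcos : IsBddSymbol (fun ξ => (Real.cos (t * absNabla ξ) : ℂ)) 1 := by
    refine ⟨?_, fun ξ => ?_⟩
    · have h1 := continuous_absNabla.measurable
      fun_prop
    · rw [Complex.norm_real]
      exact Real.abs_cos_le_one _
  rw [freeWave, fourierMul_fourierMul hcos isBddSymbol_besselSymbol]
  congr 2
  funext ξ
  rw [besselSymbol, cosSymbol, ← Complex.ofReal_mul, div_eq_mul_inv]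

lemma isSpacetimeGradient_freeWave (g₀ g₁ : L2) :
    IsSpacetimeGradient (freeWave (fourierMul besselSymbol g₀) g₁)
      fun α t => fourierMul (gradSymbolZero α t) g₀ + fourierMul (gradSymbolOne α t) g₁ := by
  have h1 : freeWave (fourierMul besselSymbol g₀) g₁
      = fun t => fourierMul (cosSymbol t) g₀ + fourierMul (sinSymbol t) g₁ :=
    funext fun t => freeWave_fourierMul_besselSymbol g₀ g₁ t
  refine ⟨fun t => ?_, fun j t => ?_⟩
  · rw [h1]
    exact (hasDerivAt_fourierMul isBddSymbol_cosSymbol isSymbolFamily_cosSymbolDeriv.symbol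
      hasDerivAt_cosSymbol g₀ t).add
      (hasDerivAt_fourierMul isBddSymbol_sinSymbol isSymbolFamily_sinSymbolDeriv.symbol
        hasDerivAt_sinSymbol g₁ t)
  · have hadd : ∀ x y : L2, ((x + y : L2) : 𝓢'(Plane, ℂ))
        = (x : 𝓢'(Plane, ℂ)) + (y : 𝓢'(Plane, ℂ)) := fun x y =>
      (Lp.toTemperedDistributionCLM ℂ (volume : Measure Plane) 2).map_add x y
    rw [h1]
    beta_reduce
    rw [hadd, hadd, LineDeriv.lineDerivOp_add,
      lineDeriv_fourierMul (isBddSymbol_cosSymbol t) j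
        ((isSymbolFamily_derivSymbol_mul_cosSymbol j).symbol t),
      lineDeriv_fourierMul (isBddSymbol_sinSymbol t) j
        ((isSymbolFamily_derivSymbol_mul_sinSymbol j).symbol t)]
    rfl

end Gradient

end RandomWave

end

/-! ### The almost sure space-time bound -/

open RandomWave
theorem mainTheorem5 {Ω : Type*} [MeasurableSpace Ω] (μ : Measure Ω) [IsProbabilityMeasure μ]
    (ψ : Plane → ℝ) (hψ : IsUnitCutoff ψ)
    (ε ν : (Fin 2 → ℤ) → Ω → ℝ)
    (hε : ∀ k, IsRademacher (ε k) μ) (hν : ∀ k, IsRademacher (ν k) μ)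
    (hε_indep : iIndepFun ε μ) (hν_indep : iIndepFun ν μ)
    (φ₀ φ₁ : L2) (hφ₀ : MemSobolev 1 2 ((φ₀ : L2) : 𝓢'(Plane, ℂ)))
    (q r : ℝ≥0∞) (hq : 2 ≤ q) (hq_top : q < ∞) (hr : 2 ≤ r) (hr_top : r < ∞)
    (I : Set ℝ) (hI : I.OrdConnected) (hI_bdd : Bornology.IsBounded I) :
    (∃ Φ₀ Φ₁ : Ω → L2, IsRandomization μ ψ ε ν φ₀ φ₁ Φ₀ Φ₁) ∧
    ∀ Φ₀ Φ₁ : Ω → L2, IsRandomization μ ψ ε ν φ₀ φ₁ Φ₀ Φ₁ →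
      ∀ᵐ ω ∂μ, ∃ v : Fin 3 → ℝ → L2,
        IsSpacetimeGradient (freeWave (Φ₀ ω) (Φ₁ ω)) v ∧ ∀ α : Fin 3, MemMixedLp q r I (v α) := by
  obtain ⟨g, rfl⟩ := exists_eq_fourierMul_besselSymbol hφ₀
  obtain ⟨G₀, hG₀⟩ := exists_isRandomSeries hψ hε hε_indep g
  obtain ⟨G₁, hG₁⟩ := exists_isRandomSeries hψ hν hν_indep φ₁
  have hεm := fun k => (hε k).measurable
  have hνm := fun k => (hν k).measurable
  refine ⟨⟨_, _, isRandomization_of_isRandomSeries hψ hεm hG₀ hG₁⟩, fun Φ₀ Φ₁ hΦ => ?_⟩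
  filter_upwards [
    hΦ.isRandomSeries_zero.ae_eq (hG₀.fourierMul hψ isBddSymbol_besselSymbol) hεm,
    hΦ.isRandomSeries_one.ae_eq hG₁ hνm,
    ae_all_iff.2 fun α => hG₀.ae_memMixedLp hψ hε hε_indep (isSymbolFamily_gradSymbolZero α)
      hq_top hr hr_top hI_bdd,
    ae_all_iff.2 fun α => hG₁.ae_memMixedLp hψ hν hν_indep (isSymbolFamily_gradSymbolOne α)
      hq_top hr hr_top hI_bdd] with ω h₀ h₁ hv₀ hv₁
  rw [h₀, h₁]
  refine ⟨_, isSpacetimeGradient_freeWave (G₀ ω) (G₁ ω), fun α => ?_⟩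
  exact (hv₀ α).of_eq_add (one_le_two.trans hr) (hv₁ α)
    (((isSymbolFamily_gradSymbolZero α).continuous_fourierMul _).add
      ((isSymbolFamily_gradSymbolOne α).continuous_fourierMul _)) fun t => rfl
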